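/- **Setting.** A congestion game has $n\ge 1$ agents and a set $E$ of $m\ge 1$ resources. Agent $i$ has a nonempty strategy space $\mathcal P_i\subseteq 2^E$, and each resource $e$ has a positive non-decreasing cost function $c_e$ of its load. For a pure profile $p=(p_1,\dots,p_n)$ the load $\ell_e(p)$ is the number of agents $i$ with $e\in p_i$, and agent $i$ pays $C_i(p)=\sum_{e\in p_i}c_e(\ell_e(p))$. Put $c_{\max}=\max_e c_e(n)$. For $\pi\in\Delta(\mathcal P_1)\times\dots\times\Delta(\mathcal P_n)$ let $c_i(\pi)$ be the expectation of $C_i(p)$ when the $p_j\sim\pi_j$ are independent; $\pi$ is an $\eta$-approximate mixed Nash equilibrium (NE) if $c_i(\pi)\le c_i(\pi_i',\pi_{-i})+\eta$ for all $i$ and all $\pi_i'\in\Delta(\mathcal P_i)$. Let $\mathcal X_i\subset\mathbb R^E$ be the convex hull of the $0/1$ incidence vectors of the strategies in $\mathcal P_i$, let $E_i=\bigcup_{p_i\in\mathcal P_i}p_i$, and let $\mathcal X_i^\mu=\{x\in\mathcal X_i: x_e\ge\mu\ \ \forall e\in E_i\}$. **Algorithm** (online gradient descent with Carathéodory exploration;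 step sizes $\gamma_t$, exploration parameters $\mu_t^i$). Agent $i$ starts from an arbitrary $x_i^1\in\mathcal X_i^{\mu_1^i}$. In each round $t=1,\dots,T$ it picks an arbitrary Carathéodory decomposition $\pi_i^t$ of $x_i^t$, i.e. a distribution on $\mathcal P_i$ supported on at most $m+1$ strategies with $\Pr_{p\sim\pi_i^t}[e\in p]=x^t_{i,e}$ for all $e\in E$; it samples $p_i^t\sim\pi_i^t$ (given the past, independently of the other agents), observes the costs $c_e(\ell_e(p^t))$ of the resources $e\in p_i^t$, sets $\hat c^t_{i,e}=c_e(\ell_e(p^t))\,\mathbf 1[e\in p_i^t]/x^t_{i,e}$ (and $0$ if $e\notin p_i^t$), and moves to $x_i^{t+1}=\Pi_{\mathcal X_i^{\mu^i_{t+1}}}[x_i^t-\gamma_t\hat c_i^t]$, where $\Pi$ is Euclidean projection. We consider two parameter choices: * *default*: $\gamma_t=t^{-3/5}$ and $\mu_t^i=\min(1/|E_i|,\,t^{-1/5})$; * *tuned*, with constants $a,b>0$: $\gamma_t=a\,m^{-4/5}n^{-8/5}c_{\max}^{-1}t^{-3/5}$ and $\mu_t^i=\min(1/|E_i|,\,b\,n^{-6/5}m^{-11/10}t^{-1/5})$.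 (If $E_i=\emptyset$, then $\mathcal X_i^\mu=\mathcal X_i$ for all $\mu$ and the parameter is irrelevant.) **Corollary 3.8.** For every $M>0$ and $a,b>0$ there is a constant $C>0$ depending only on $M,a,b$ (for the default parameters: only on $M$) such that the following holds for every congestion game with $c_{\max}\le M$, every $\epsilon>0$, every $\delta\in(0,1)$ and every integer $T\ge1$ with $$T\ \ge\ C\,\frac{n^{6.5}m^{7}}{\epsilon^5}\quad\text{(tuned parameters)}\qquad\text{resp.}\qquad T\ \ge\ C\,\frac{m^{12.5}n^{7.5}}{\epsilon^5}\quad\text{(default parameters)}.$$ If all agents run the algorithm, and $\pi^1,\dots,\pi^T$ are the resulting mixed strategy profiles, then * with probability at least $1-\delta$, at least $(1-\delta)T$ of the profiles $\pi^1,\dots,\pi^T$ are $\epsilon/\delta^2$-approximate mixed NE; * if $t$ is drawn uniformly from $\{1,\dots,T\}$, independently of the run, then with probability at least $1-\delta$ (over both the run and $t$) the profile $\pi^t$ is an $\epsilon/\delta$-approximate mixed NE. -/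

import Mathlib

open MeasureTheory ProbabilityTheory

noncomputable section

/-- A congestion game with agents `Fin n` and resources `Fin m`.  `strat i` is the strategy space
of agent `i` (a nonempty family of sets of resources) and `cost e ℓ` is the cost of resource `e`
under load `ℓ`.  Costs are non-decreasing and positive; at load `0` (a load that no agent ever
pays for) only nonnegativity is required. -/
structure CongestionGame (n m : ℕ) where
  strat : Fin n → Finset (Finset (Fin m))
  strat_nonempty : ∀ i, (strat i).Nonempty
  cost : Fin m → ℕ → ℝ
  cost_zero_nonneg : ∀ e, 0 ≤ cost e 0
  cost_pos : ∀ e ℓ, 1 ≤ ℓ → 0 < cost e ℓ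
  cost_mono : ∀ e, Monotone (cost e)

namespace CongestionGame

variable {n m : ℕ} (G : CongestionGame n m)

/-- The maximal congestion cost `max_e c_e(n)`. -/
def cMax : ℝ := ⨆ e : Fin m, G.cost e n

/-- Pure strategy profiles. -/
abbrev Profile : Type := ∀ i : Fin n, {s : Finset (Fin m) // s ∈ G.strat i}

/-- Families of weights on the strategies of each agent; such a family is a mixed strategy profile
when each component lies in the standard simplex. -/
abbrev MixedProfile : Type := ∀ i : Fin n, {s : Finset (Fin m) // s ∈ G.strat i} → ℝ

/-- The number of agents using resource `e`. -/
def load (p : G.Profile) (e : Fin m) : ℕ :=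
  (Finset.univ.filter fun i : Fin n => e ∈ (p i).1).card

/-- The cost of agent `i` under a pure profile. -/
def agentCost (i : Fin n) (p : G.Profile) : ℝ :=
  ∑ e ∈ (p i).1, G.cost e (G.load p e)

/-- The expected cost of agent `i` when the agents sample independently from `π`. -/
def expectedCost (i : Fin n) (π : G.MixedProfile) : ℝ :=
  ∑ p : G.Profile, (∏ j, π j (p j)) * G.agentCost i p

/-- `π` is an `η`-approximate mixed Nash equilibrium. -/
def IsApproxMixedNE (η : ℝ) (π : G.MixedProfile) : Prop :=
  (∀ i, π i ∈ stdSimplex ℝ {s : Finset (Fin m) // s ∈ G.strat i}) ∧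
  ∀ i, ∀ q ∈ stdSimplex ℝ {s : Finset (Fin m) // s ∈ G.strat i},
    G.expectedCost i π ≤ G.expectedCost i (Function.update π i q) + η

/-- The 0/1 incidence vector of a set of resources. -/
def incidence (s : Finset (Fin m)) : EuclideanSpace ℝ (Fin m) :=
  WithLp.toLp 2 fun e => if e ∈ s then 1 else 0

/-- The description polytope of agent `i`: the convex hull of the incidence vectors of its
strategies. -/
def polytope (i : Fin n) : Set (EuclideanSpace ℝ (Fin m)) :=
  convexHull ℝ (incidence '' {s : Finset (Fin m) | s ∈ G.strat i})

/-- The resources contained in some strategy of agent `i`. -/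
def active (i : Fin n) : Finset (Fin m) :=
  Finset.univ.filter fun e => ∃ s ∈ G.strat i, e ∈ s

/-- The bounded-away description polytope with exploration parameter `μ`. -/
def boundedAway (i : Fin n) (μ : ℝ) : Set (EuclideanSpace ℝ (Fin m)) :=
  {x | x ∈ G.polytope i ∧ ∀ e ∈ G.active i, μ ≤ x e}

/-- `q` is a Carathéodory decomposition of `x`: a probability distribution on the strategies of
agent `i`, supported on at most `m + 1` of them, whose marginals are the coordinates of `x`. -/
def IsCaratheodory (i : Fin n) (x : EuclideanSpace ℝ (Fin m))
    (q : {s : Finset (Fin m) // s ∈ G.strat i} → ℝ) : Prop :=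
  q ∈ stdSimplex ℝ {s : Finset (Fin m) // s ∈ G.strat i} ∧
  {s | q s ≠ 0}.ncard ≤ m + 1 ∧
  ∀ e, x e = ∑ s : {s : Finset (Fin m) // s ∈ G.strat i}, if e ∈ s.1 then q s else 0

/-- The importance-weighted cost estimate of agent `i` at the fractional point `x` after the pure
profile `p` has been played: `c_e / x_e` on the resources that agent `i` selected, `0` elsewhere.
It only uses the costs of the resources selected by agent `i`. -/
def costEstimate (i : Fin n) (p : G.Profile) (x : EuclideanSpace ℝ (Fin m)) :
    EuclideanSpace ℝ (Fin m) :=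
  WithLp.toLp 2 fun e => if e ∈ (p i).1 then G.cost e (G.load p e) / x e else 0

/-- `z` is a Euclidean projection of `y` onto `K` (the only one if `K` is convex). -/
def IsProjection (K : Set (EuclideanSpace ℝ (Fin m))) (y z : EuclideanSpace ℝ (Fin m)) : Prop :=
  z ∈ K ∧ ∀ w ∈ K, ‖y - z‖ ≤ ‖y - w‖

/-- The random process generated during rounds `1, …, T` when all agents run online gradient
descent with Carathéodory exploration, with step sizes `γ t` and exploration parameters `μ i t`.

`x t ω i`, `π t ω i` and `p t ω i` are the fractional point, the mixed strategy and the sampled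
strategy of agent `i` in round `t`; `ℱ t` is the information available just before the agents
sample in round `t`.  Initial points and Carathéodory decompositions are arbitrary; given `ℱ t`,
the agents sample independently of each other, agent `i` from `π t ω i`. -/
structure IsRun (γ : ℕ → ℝ) (μ : Fin n → ℕ → ℝ) (T : ℕ)
    {Ω : Type*} [mΩ : MeasurableSpace Ω] (P : Measure Ω) (ℱ : Filtration ℕ mΩ)
    (x : ℕ → Ω → Fin n → EuclideanSpace ℝ (Fin m))
    (π : ℕ → Ω → G.MixedProfile) (p : ℕ → Ω → G.Profile) : Prop where
  measurable_point : ∀ t, 1 ≤ t → t ≤ T → Measurable[ℱ t] (x t)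
  measurable_mixed : ∀ t, 1 ≤ t → t ≤ T → Measurable[ℱ t] (π t)
  measurable_pure : ∀ t, 1 ≤ t → t ≤ T → ∀ a, MeasurableSet[ℱ (t + 1)] {ω | p t ω = a}
  init : ∀ ω i, x 1 ω i ∈ G.boundedAway i (μ i 1)
  decompose : ∀ t, 1 ≤ t → t ≤ T → ∀ ω i, G.IsCaratheodory i (x t ω i) (π t ω i)
  sample : ∀ t, 1 ≤ t → t ≤ T → ∀ a : G.Profile,
    P[Set.indicator {ω | p t ω = a} (fun _ => (1 : ℝ)) | ℱ t] =ᵐ[P] fun ω => ∏ i, π t ω i (a i)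
  update : ∀ t, 1 ≤ t → t < T → ∀ ω i,
    IsProjection (G.boundedAway i (μ i (t + 1)))
      (x t ω i - γ t • G.costEstimate i (p t ω) (x t ω i)) (x (t + 1) ω i)

/-- The default step sizes `t^{-3/5}`. -/
def defaultStep (t : ℕ) : ℝ := (t : ℝ) ^ (-(3 / 5) : ℝ)

/-- The default exploration parameters `min(1/|E_i|, t^{-1/5})`.  (If `E_i` is empty, the
bounded-away polytope does not depend on the parameter.) -/
def defaultExploration (i : Fin n) (t : ℕ) : ℝ :=
  min (1 / ((G.active i).card : ℝ)) ((t : ℝ) ^ (-(1 / 5) : ℝ))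

/-- The tuned step sizes `a m^{-4/5} n^{-8/5} c_max^{-1} t^{-3/5}`. -/
def tunedStep (a : ℝ) (t : ℕ) : ℝ :=
  a * (m : ℝ) ^ (-(4 / 5) : ℝ) * (n : ℝ) ^ (-(8 / 5) : ℝ) * (G.cMax)⁻¹ * (t : ℝ) ^ (-(3 / 5) : ℝ)

/-- The tuned exploration parameters `min(1/|E_i|, b n^{-6/5} m^{-11/10} t^{-1/5})`. -/
def tunedExploration (b : ℝ) (i : Fin n) (t : ℕ) : ℝ :=
  min (1 / ((G.active i).card : ℝ))
    (b * (n : ℝ) ^ (-(6 / 5) : ℝ) * (m : ℝ) ^ (-(11 / 10) : ℝ) * (t : ℝ) ^ (-(1 / 5) : ℝ))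

end CongestionGame

end

/-! The expected Rosenthal potential is viewed as a function of the usage probabilities. For one
resource `e` only the events that agent `j` selects `e` matter; these are independent with
probabilities `x j e`, so the potential is affine in each coordinate. Its partial derivative in `x i
e` is `marginal`, the expected cost of `e` to agent `i` when using it, and this does not depend on
the point of agent `i`. Hence each agent's cost is linear in its own point with the gradient as
coefficients, deviation gains are inner products with the gradient, and a small `nashGap` means an
approximate equilibrium. The algorithm is projected stochastic gradient descent on the potential:
the estimates are unbiased on active resources, with second moment at most `cMax ^ 2 * (m + 1 / σ)`
per coordinate.

The potential is not convex, but it lies above its tangent planes up to an error `n * cMax` times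
the squared distance (`potential_lower`). The Moreau envelope with weight `2 * n * cMax` therefore
serves as a Lyapunov function. Let `x'` be the minimizer defining the envelope at `x`. One
stochastic step lowers the envelope in expectation by `4 n² cMax² γ` times the squared distance from
`x` to `x'`, up to noise of order `γ²` (`prodExp_envelope_le`); projecting, and enlarging the domain
as exploration decreases, cannot raise it (`envelope_projection_le`). Conversely, first-order
optimality of `x'` bounds the gap at `x` by a multiple of the distance to `x'` plus a bias `m² cMax
σ` caused by exploration (`nashGap_le_of_envelope`).

Dividing the descent inequality by the step size and summing (`sum_le_of_descent`) bounds the total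
squared excess of the gap over the bias. With steps of order `t^(-3/5)` and exploration of order
`t^(-1/5)`, both `1 / γ T` and the accumulated noise have order `T^(3/5)`, so the mean expected gap
has order `T^(-1/5)`. Markov's inequality turns this into both probabilistic statements
(`markov_average`). -/

noncomputable section

set_option linter.unusedSectionVars false

/-! ### Expectations under product weights -/

section ProductExpectation

variable {ι : Type*} [Fintype ι] [DecidableEq ι] {A : ι → Type*} [∀ i, Fintype (A i)]

/-- The weighted sum of `g` with respect to the product of the weights `w j`. -/
def prodExp (w : ∀ j, A j → ℝ) (g : (∀ j, A j) → ℝ) : ℝ :=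
  ∑ p, (∏ j, w j (p j)) * g p

/-- Resampling coordinate `i`: after inserting the factor `∑ a, w i a = 1`, both sides are sums over
pairs `(a, p)`, matched by the involution that swaps `a` with `p i`. -/
theorem prodExp_update (w : ∀ j, A j → ℝ) (i : ι) (hi : ∑ a, w i a = 1) (v : A i → ℝ)
    (g : (∀ j, A j) → ℝ) :
    prodExp (Function.update w i v) g =
      ∑ a, v a * prodExp w (fun p => g (Function.update p i a)) := by
  have hprod : ∀ (u : ∀ j, A j → ℝ) (p : ∀ j, A j),
      ∏ j, u j (p j) = u i (p i) * ∏ j ∈ Finset.univ.erase i, u j (p j) := fun u p =>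
    (Finset.mul_prod_erase _ _ (Finset.mem_univ i)).symm
  have hL : prodExp (Function.update w i v) g = ∑ q : A i × (∀ j, A j),
      w i q.1 * (v (q.2 i) * (∏ j ∈ Finset.univ.erase i, w j (q.2 j)) * g q.2) := by
    rw [Fintype.sum_prod_type]
    simp only
    rw [← Finset.sum_mul_sum, hi, one_mul]
    refine Finset.sum_congr rfl fun p _ => ?_
    rw [hprod]
    have : ∀ j ∈ Finset.univ.erase i, Function.update w i v j (p j) = w j (p j) := by
      intro j hj
      rw [Function.update_of_ne (Finset.ne_of_mem_erase hj)]
    rw [Finset.prod_congr rfl this, Function.update_self]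
  have hR : ∑ a, v a * prodExp w (fun p => g (Function.update p i a)) =
      ∑ q : A i × (∀ j, A j),
        v q.1 * (w i (q.2 i) * (∏ j ∈ Finset.univ.erase i, w j (q.2 j))
          * g (Function.update q.2 i q.1)) := by
    rw [Fintype.sum_prod_type]
    refine Finset.sum_congr rfl fun a _ => ?_
    rw [prodExp, Finset.mul_sum]
    refine Finset.sum_congr rfl fun p _ => ?_
    rw [hprod]
  rw [hL, hR]
  have hinv : Function.Involutive
      (fun q : A i × (∀ j, A j) => (q.2 i, Function.update q.2 i q.1)) := by
    rintro ⟨a, p⟩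
    simp
  refine Fintype.sum_equiv hinv.toPerm _ _ ?_
  rintro ⟨a, p⟩
  have : ∀ j ∈ Finset.univ.erase i, w j (Function.update p i a j) = w j (p j) := by
    intro j hj
    rw [Function.update_of_ne (Finset.ne_of_mem_erase hj)]
  simp only [Function.Involutive.coe_toPerm, Function.update_self, Function.update_idem,
    Function.update_eq_self]
  rw [Finset.prod_congr rfl this]
  ring

theorem prodExp_mono {w : ∀ j, A j → ℝ} (hw : ∀ j a, 0 ≤ w j a) {g g' : (∀ j, A j) → ℝ}
    (h : ∀ p, g p ≤ g' p) : prodExp w g ≤ prodExp w g' :=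
  Finset.sum_le_sum fun p _ =>
    mul_le_mul_of_nonneg_left (h p) (Finset.prod_nonneg fun j _ => hw j _)

theorem prodExp_const {w : ∀ j, A j → ℝ} (hw : ∀ j, ∑ a, w j a = 1) (c : ℝ) :
    prodExp w (fun _ => c) = c := by
  rw [prodExp, ← Finset.sum_mul]
  have := Finset.prod_univ_sum (fun j => (Finset.univ : Finset (A j))) w
  rw [Fintype.piFinset_univ] at this
  rw [← this]
  simp [hw]

/-- The image of a product of weights under a coordinatewise map is the product of the image
weights. This is what reduces mixed profiles to independent Bernoulli variables, one resource at a
time. -/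
theorem prodExp_map {B : ι → Type*} [∀ i, Fintype (B i)] [∀ i, DecidableEq (B i)]
    (f : ∀ j, A j → B j) (w : ∀ j, A j → ℝ) (g : (∀ j, B j) → ℝ) :
    prodExp w (fun p => g (fun j => f j (p j))) =
      prodExp (fun j b => ∑ a, if f j a = b then w j a else 0) g := by
  unfold prodExp
  have h : ∀ q : ∀ j, B j, ∏ j, (∑ a, if f j a = q j then w j a else 0) =
      ∑ p : ∀ j, A j, if (fun j => f j (p j)) = q then ∏ j, w j (p j) else 0 := by
    intro q
    have := Finset.prod_univ_sum (fun j => (Finset.univ : Finset (A j)))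
      (fun j a => if f j a = q j then w j a else 0)
    rw [Fintype.piFinset_univ] at this
    rw [this]
    refine Finset.sum_congr rfl fun p _ => ?_
    rw [Finset.prod_ite_zero]
    simp [funext_iff]
  simp_rw [h, Finset.sum_mul]
  rw [Finset.sum_comm]
  refine Finset.sum_congr rfl fun p _ => ?_
  simp [ite_mul]

end ProductExpectation

/-! ### Multilinear calculus of one resource: potential, marginal cost, weak convexity -/

section Bernoulli

variable {ι : Type*} [Fintype ι] [DecidableEq ι]

/-- Bernoulli weights with success probability `z j`. -/
def bern (z : ι → ℝ) : ι → Bool → ℝ := fun j b => if b then z j else 1 - z j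

theorem sum_bern (z : ι → ℝ) (j : ι) : ∑ b, bern z j b = 1 := by
  simp [bern]

theorem bern_nonneg {z : ι → ℝ} (hz : ∀ j, z j ∈ Set.Icc (0 : ℝ) 1) (j : ι) (b : Bool) :
    0 ≤ bern z j b := by
  have := hz j
  cases b <;> simp [bern, this.1, this.2]

theorem prodExp_bern_update (z : ι → ℝ) (i : ι) (v : ℝ) (g : (ι → Bool) → ℝ) :
    prodExp (bern (Function.update z i v)) g =
      v * prodExp (bern z) (fun b => g (Function.update b i true)) +
        (1 - v) * prodExp (bern z) (fun b => g (Function.update b i false)) := by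
  have h : bern (Function.update z i v) =
      Function.update (bern z) i (fun b => if b then v else 1 - v) := by
    funext j
    by_cases hj : j = i
    · subst hj; funext b; simp [bern]
    · funext b; simp [bern, hj]
  rw [h, prodExp_update _ _ (sum_bern z i)]
  simp

theorem prodExp_bern_split (z : ι → ℝ) (i : ι) (g : (ι → Bool) → ℝ) :
    prodExp (bern z) g =
      z i * prodExp (bern z) (fun b => g (Function.update b i true)) +
        (1 - z i) * prodExp (bern z) (fun b => g (Function.update b i false)) := by
  rw [← prodExp_bern_update, Function.update_eq_self]

theorem prodExp_sub {A : ι → Type*} [∀ i, Fintype (A i)] (w : ∀ j, A j → ℝ)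
    (g g' : (∀ j, A j) → ℝ) :
    prodExp w (fun p => g p - g' p) = prodExp w g - prodExp w g' := by
  simp [prodExp, mul_sub, Finset.sum_sub_distrib]

theorem prodExp_bern_mem {z : ι → ℝ} (hz : ∀ j, z j ∈ Set.Icc (0 : ℝ) 1) {g : (ι → Bool) → ℝ}
    {c : ℝ} (hg : ∀ b, g b ∈ Set.Icc 0 c) : prodExp (bern z) g ∈ Set.Icc 0 c := by
  constructor
  · rw [← prodExp_const (sum_bern z) 0]
    exact prodExp_mono (bern_nonneg hz) fun p => (hg p).1
  · rw [← prodExp_const (sum_bern z) c]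
    exact prodExp_mono (bern_nonneg hz) fun p => (hg p).2

theorem piecewise_mem {y z : ι → ℝ} (hy : ∀ j, y j ∈ Set.Icc (0 : ℝ) 1)
    (hz : ∀ j, z j ∈ Set.Icc (0 : ℝ) 1) (S : Finset ι) (j : ι) :
    S.piecewise y z j ∈ Set.Icc (0 : ℝ) 1 := by
  by_cases h : j ∈ S <;> simp only [h, Finset.piecewise, if_true, if_false]
  · exact hy j
  · exact hz j

/-- The coordinates are changed one at a time. Changing coordinate `i` alters the expectation by `y
i - z i` times a difference of two numbers in `[0, c]`. -/
theorem abs_prodExp_bern_piecewise_sub_le {y z : ι → ℝ} (hy : ∀ j, y j ∈ Set.Icc (0 : ℝ) 1)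
    (hz : ∀ j, z j ∈ Set.Icc (0 : ℝ) 1) {g : (ι → Bool) → ℝ} {c : ℝ}
    (hg : ∀ b, g b ∈ Set.Icc 0 c) (S : Finset ι) :
    |prodExp (bern (S.piecewise y z)) g - prodExp (bern z) g| ≤ c * ∑ j ∈ S, |y j - z j| := by
  induction S using Finset.induction_on with
  | empty => simp
  | insert i S hi ih =>
    rw [Finset.piecewise_insert, Finset.sum_insert hi, mul_add]
    set u := S.piecewise y z
    have hu : ∀ j, u j ∈ Set.Icc (0 : ℝ) 1 := piecewise_mem hy hz S
    have hui : u i = z i := by simp [u, hi]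
    have h1 := prodExp_bern_mem hu (g := fun b => g (Function.update b i true)) (c := c)
      fun b => hg _
    have h2 := prodExp_bern_mem hu (g := fun b => g (Function.update b i false)) (c := c)
      fun b => hg _
    have h3 : prodExp (bern (Function.update u i (y i))) g - prodExp (bern z) g =
        (y i - z i) * (prodExp (bern u) (fun b => g (Function.update b i true)) -
          prodExp (bern u) (fun b => g (Function.update b i false))) +
        (prodExp (bern u) g - prodExp (bern z) g) := by
      rw [prodExp_bern_update, prodExp_bern_split u i g, hui]
      ring
    rw [h3]
    refine (abs_add_le _ _).trans (add_le_add ?_ ih)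
    rw [abs_mul, mul_comm]
    refine mul_le_mul_of_nonneg_right ?_ (abs_nonneg _)
    rw [abs_le]
    constructor <;> linarith [h1.1, h1.2, h2.1, h2.2]

theorem abs_prodExp_bern_sub_le {y z : ι → ℝ} (hy : ∀ j, y j ∈ Set.Icc (0 : ℝ) 1)
    (hz : ∀ j, z j ∈ Set.Icc (0 : ℝ) 1) {g : (ι → Bool) → ℝ} {c : ℝ}
    (hg : ∀ b, g b ∈ Set.Icc 0 c) :
    |prodExp (bern y) g - prodExp (bern z) g| ≤ c * ∑ j, |y j - z j| := by
  simpa using abs_prodExp_bern_piecewise_sub_le hy hz hg Finset.univ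

/-- The number of successes. -/
def successes (b : ι → Bool) : ℕ := (Finset.univ.filter fun j => b j = true).card

theorem successes_update_true (b : ι → Bool) (i : ι) :
    successes (Function.update b i true) = successes (Function.update b i false) + 1 := by
  unfold successes
  have h : (Finset.univ.filter fun j => Function.update b i true j = true) =
      insert i (Finset.univ.filter fun j => Function.update b i false j = true) := by
    ext j
    by_cases hj : j = i
    · subst hj; simp
    · simp [hj]
  rw [h, Finset.card_insert_of_notMem (by simp)]

theorem successes_le (b : ι → Bool) : successes b ≤ Fintype.card ι :=
  Finset.card_filter_le _ _

/-- The expected Rosenthal potential of one resource with cost function `c`, when agent `j` uses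
it with probability `z j`. -/
def resourcePotential (c : ℕ → ℝ) (z : ι → ℝ) : ℝ :=
  prodExp (bern z) fun b => ∑ l ∈ Finset.range (successes b), c (l + 1)

/-- The expected cost of one resource for agent `i`, if `i` uses it. -/
def marginalCost (c : ℕ → ℝ) (z : ι → ℝ) (i : ι) : ℝ :=
  prodExp (bern z) fun b => c (successes (Function.update b i true))

/-- The expectation is affine in `z i`, with slope the expected increment of the potential when `i`
joins. That increment is the last summand of the Rosenthal sum, the cost at the load including `i`.
-/
theorem resourcePotential_update (c : ℕ → ℝ) (z : ι → ℝ) (i : ι) (v : ℝ) :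
    resourcePotential c (Function.update z i v) =
      resourcePotential c z + (v - z i) * marginalCost c z i := by
  have h : marginalCost c z i =
      prodExp (bern z) (fun b => ∑ l ∈ Finset.range (successes (Function.update b i true)),
        c (l + 1)) -
      prodExp (bern z) (fun b => ∑ l ∈ Finset.range (successes (Function.update b i false)),
        c (l + 1)) := by
    rw [← prodExp_sub, marginalCost]
    congr 1
    funext b
    rw [successes_update_true, Finset.sum_range_succ]
    ring
  rw [h]
  unfold resourcePotential
  rw [prodExp_bern_update,
    prodExp_bern_split z i (fun b => ∑ l ∈ Finset.range (successes b), c (l + 1))]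
  ring

theorem marginalCost_update (c : ℕ → ℝ) (z : ι → ℝ) (i : ι) (v : ℝ) :
    marginalCost c (Function.update z i v) i = marginalCost c z i := by
  unfold marginalCost
  rw [prodExp_bern_update]
  simp only [Function.update_idem]
  ring

theorem prodExp_bern_mul_marginal (c : ℕ → ℝ) (z : ι → ℝ) (i : ι) :
    prodExp (bern z) (fun b => if b i then c (successes b) else 0) =
      z i * marginalCost c z i := by
  rw [prodExp_bern_split z i]
  simp only [Function.update_self, if_true, marginalCost]
  simp [prodExp]

variable {c : ℕ → ℝ} {K : ℝ}

theorem marginalCost_mem (hc : ∀ l, l ≤ Fintype.card ι → c l ∈ Set.Icc 0 K) {z : ι → ℝ}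
    (hz : ∀ j, z j ∈ Set.Icc (0 : ℝ) 1) (i : ι) : marginalCost c z i ∈ Set.Icc 0 K :=
  prodExp_bern_mem hz fun _ => hc _ (successes_le _)

theorem resourcePotential_mem (hK : 0 ≤ K)
    (hc : ∀ l, l ≤ Fintype.card ι → c l ∈ Set.Icc 0 K) {z : ι → ℝ}
    (hz : ∀ j, z j ∈ Set.Icc (0 : ℝ) 1) :
    resourcePotential c z ∈ Set.Icc 0 (Fintype.card ι * K) := by
  refine prodExp_bern_mem hz fun b => ⟨Finset.sum_nonneg fun l hl => ?_, ?_⟩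
  · rw [Finset.mem_range] at hl
    exact (hc _ (hl.trans_le (successes_le b))).1
  · calc ∑ l ∈ Finset.range (successes b), c (l + 1)
        ≤ ∑ l ∈ Finset.range (successes b), K := Finset.sum_le_sum fun l hl => by
          rw [Finset.mem_range] at hl
          exact (hc _ (hl.trans_le (successes_le b))).2
      _ = successes b * K := by simp
      _ ≤ Fintype.card ι * K := by
          gcongr
          exact successes_le b

theorem abs_marginalCost_sub_le (hc : ∀ l, l ≤ Fintype.card ι → c l ∈ Set.Icc 0 K) {y z : ι → ℝ}
    (hy : ∀ j, y j ∈ Set.Icc (0 : ℝ) 1) (hz : ∀ j, z j ∈ Set.Icc (0 : ℝ) 1) (i : ι) :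
    |marginalCost c y i - marginalCost c z i| ≤ K * ∑ j, |y j - z j| :=
  abs_prodExp_bern_sub_le hy hz fun _ => hc _ (successes_le _)

/-- Passing from `z` to `y` one coordinate at a time, each move is exactly linear with the slope at
the current point. That slope differs from the one at `z` by at most `K` times the ℓ¹ distance of
`y` and `z`, so the total error is `K` times the squared ℓ¹ distance; Cauchy–Schwarz converts it to
the Euclidean one. -/
theorem resourcePotential_lower (hK : 0 ≤ K)
    (hc : ∀ l, l ≤ Fintype.card ι → c l ∈ Set.Icc 0 K)
    {y z : ι → ℝ} (hy : ∀ j, y j ∈ Set.Icc (0 : ℝ) 1) (hz : ∀ j, z j ∈ Set.Icc (0 : ℝ) 1) :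
    resourcePotential c z + ∑ i, (y i - z i) * marginalCost c z i -
      K * Fintype.card ι * ∑ i, (y i - z i) ^ 2 ≤ resourcePotential c y := by
  set R := ∑ j, |y j - z j| with hR
  have key : ∀ S : Finset ι, resourcePotential c z + ∑ i ∈ S, (y i - z i) * marginalCost c z i -
      K * R * ∑ i ∈ S, |y i - z i| ≤ resourcePotential c (S.piecewise y z) := by
    intro S
    induction S using Finset.induction_on with
    | empty => simp
    | insert i S hi ih =>
      rw [Finset.piecewise_insert, resourcePotential_update, Finset.sum_insert hi,
        Finset.sum_insert hi]
      have hui : S.piecewise y z i = z i := by simp [hi]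
      rw [hui]
      have h1 : |marginalCost c (S.piecewise y z) i - marginalCost c z i| ≤ K * R := by
        refine (abs_prodExp_bern_piecewise_sub_le hy hz (fun _ => hc _ (successes_le _)) S).trans ?_
        refine mul_le_mul_of_nonneg_left ?_ hK
        exact Finset.sum_le_sum_of_subset_of_nonneg (Finset.subset_univ _)
          fun _ _ _ => abs_nonneg _
      have h2 : |(y i - z i) * (marginalCost c (S.piecewise y z) i - marginalCost c z i)| ≤
          |y i - z i| * (K * R) := by
        rw [abs_mul]
        exact mul_le_mul_of_nonneg_left h1 (abs_nonneg _)
      have h3 := (abs_le.1 h2).1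
      nlinarith
  have h := key Finset.univ
  rw [Finset.piecewise_univ] at h
  have hCS : R * R ≤ Fintype.card ι * ∑ i, (y i - z i) ^ 2 := by
    have := sq_sum_le_card_mul_sum_sq (s := Finset.univ) (f := fun i => |y i - z i|)
    simp only [sq_abs, Finset.card_univ] at this
    nlinarith
  have := mul_le_mul_of_nonneg_left hCS hK
  rw [← hR] at h
  nlinarith

end Bernoulli

/-! ### Expected costs and cost estimates in terms of usage probabilities -/

namespace CongestionGame

variable {n m : ℕ} (G : CongestionGame n m)

theorem cost_mem (e : Fin m) {l : ℕ} (hl : l ≤ n) : G.cost e l ∈ Set.Icc 0 G.cMax :=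
  ⟨(G.cost_zero_nonneg e).trans (G.cost_mono e (Nat.zero_le l)),
    (G.cost_mono e hl).trans
      (le_ciSup (f := fun e => G.cost e n) (Set.finite_range _).bddAbove e)⟩

theorem cost_mem' (e : Fin m) (l : ℕ) (hl : l ≤ Fintype.card (Fin n)) :
    G.cost e l ∈ Set.Icc 0 G.cMax :=
  G.cost_mem e (by simpa using hl)

theorem cMax_nonneg : 0 ≤ G.cMax :=
  Real.iSup_nonneg fun e => (G.cost_mem e le_rfl).1

theorem cMax_pos (hn : 0 < n) (hm : 0 < m) : 0 < G.cMax :=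
  (G.cost_pos ⟨0, hm⟩ n hn).trans_le (G.cost_mem ⟨0, hm⟩ le_rfl).2

/-- The expected potential at a family of fractional points. -/
def potential (x : Fin n → EuclideanSpace ℝ (Fin m)) : ℝ :=
  ∑ e, resourcePotential (G.cost e) fun j => x j e

/-- The expected cost of resource `e` for agent `i`, if `i` uses it. -/
def marginal (x : Fin n → EuclideanSpace ℝ (Fin m)) (i : Fin n) (e : Fin m) : ℝ :=
  marginalCost (G.cost e) (fun j => x j e) i

/-- The usage probabilities of the resources under a distribution on strategies. -/
def usage (i : Fin n) (q : {s : Finset (Fin m) // s ∈ G.strat i} → ℝ) :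
    EuclideanSpace ℝ (Fin m) :=
  WithLp.toLp 2 fun e => ∑ s : {s : Finset (Fin m) // s ∈ G.strat i}, if e ∈ s.1 then q s else 0

/-- `π` is a mixed profile with usage probabilities `x`. -/
def Represents (π : G.MixedProfile) (x : Fin n → EuclideanSpace ℝ (Fin m)) : Prop :=
  ∀ i, π i ∈ stdSimplex ℝ {s : Finset (Fin m) // s ∈ G.strat i} ∧ x i = G.usage i (π i)

variable {G} {π : G.MixedProfile} {x : Fin n → EuclideanSpace ℝ (Fin m)}

/-- Independence of the agents makes the indicators of using `e` independent, so the law of the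
users of one resource depends on `π` only through `x`. -/
theorem prodExp_usage (h : G.Represents π x) (e : Fin m) (g : (Fin n → Bool) → ℝ) :
    prodExp π (fun p => g fun j => decide (e ∈ (p j).1)) = prodExp (bern fun j => x j e) g := by
  rw [prodExp_map (fun (j : Fin n) (s : {s : Finset (Fin m) // s ∈ G.strat j}) =>
    decide (e ∈ s.1))]
  congr 1
  funext j b
  have h1 := (h j).1.2
  have hx : x j e = ∑ s : {s : Finset (Fin m) // s ∈ G.strat j}, if e ∈ s.1 then π j s else 0 := by
    rw [(h j).2]; rfl
  cases b
  · simp only [bern, hx]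
    rw [← h1, if_neg (by simp), ← Finset.sum_sub_distrib]
    refine Finset.sum_congr rfl fun s _ => ?_
    by_cases hs : e ∈ s.1 <;> simp [hs]
  · simp [bern, hx]

theorem load_eq_successes (p : G.Profile) (e : Fin m) :
    G.load p e = successes fun j => decide (e ∈ (p j).1) := by
  simp [load, successes]

theorem prodExp_finset_sum {ι κ : Type*} [Fintype ι] [DecidableEq ι] {A : ι → Type*}
    [∀ i, Fintype (A i)] (w : ∀ j, A j → ℝ) (s : Finset κ) (g : κ → (∀ j, A j) → ℝ) :
    prodExp w (fun p => ∑ k ∈ s, g k p) = ∑ k ∈ s, prodExp w (g k) := by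
  simp only [prodExp, Finset.mul_sum]
  exact Finset.sum_comm

theorem prodExp_mul_const {ι : Type*} [Fintype ι] [DecidableEq ι] {A : ι → Type*}
    [∀ i, Fintype (A i)] (w : ∀ j, A j → ℝ) (g : (∀ j, A j) → ℝ) (c : ℝ) :
    prodExp w (fun p => g p * c) = prodExp w g * c := by
  simp only [prodExp, Finset.sum_mul, mul_assoc]

theorem prodExp_used_cost (h : G.Represents π x) (i : Fin n) (e : Fin m) :
    prodExp π (fun p => if e ∈ (p i).1 then G.cost e (G.load p e) else 0) =
      x i e * G.marginal x i e := by
  have h2 := prodExp_bern_mul_marginal (G.cost e) (fun j => x j e) i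
  rw [← prodExp_usage h] at h2
  rw [marginal, ← h2]
  simp [load_eq_successes]

theorem prodExp_used (h : G.Represents π x) (i : Fin n) (e : Fin m) :
    prodExp π (fun p => if e ∈ (p i).1 then (1 : ℝ) else 0) = x i e := by
  have h2 := prodExp_bern_mul_marginal (fun _ => 1) (fun j => x j e) i
  rw [← prodExp_usage h] at h2
  have h3 : marginalCost (fun _ => (1 : ℝ)) (fun j => x j e) i = 1 :=
    prodExp_const (sum_bern _) 1
  rw [h3, mul_one] at h2
  rw [← h2]
  simp

theorem expectedCost_eq (h : G.Represents π x) (i : Fin n) :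
    G.expectedCost i π = ∑ e, x i e * G.marginal x i e := by
  have : G.expectedCost i π = prodExp π (fun p => ∑ e,
      if e ∈ (p i).1 then G.cost e (G.load p e) else 0) := by
    unfold expectedCost prodExp agentCost
    simp
  rw [this, prodExp_finset_sum]
  exact Finset.sum_congr rfl fun e _ => prodExp_used_cost h i e

theorem costEstimate_apply (i : Fin n) (p : G.Profile) (y : EuclideanSpace ℝ (Fin m))
    (e : Fin m) : G.costEstimate i p y e =
      (if e ∈ (p i).1 then G.cost e (G.load p e) else 0) * (y e)⁻¹ := by
  simp only [costEstimate, ite_mul, zero_mul]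
  rfl

theorem prodExp_costEstimate (h : G.Represents π x) (i : Fin n) (e : Fin m) (hx : x i e ≠ 0) :
    prodExp π (fun p => G.costEstimate i p (x i) e) = G.marginal x i e := by
  simp_rw [costEstimate_apply]
  rw [prodExp_mul_const, prodExp_used_cost h]
  field_simp

theorem mem_active {i : Fin n} (p : G.Profile) {e : Fin m} (he : e ∈ (p i).1) :
    e ∈ G.active i := by
  simp only [active, Finset.mem_filter, Finset.mem_univ, true_and]
  exact ⟨(p i).1, (p i).2, he⟩

theorem costEstimate_of_notMem (i : Fin n) (p : G.Profile) (y : EuclideanSpace ℝ (Fin m))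
    {e : Fin m} (he : e ∉ G.active i) : G.costEstimate i p y e = 0 := by
  rw [costEstimate_apply, if_neg fun h => he (mem_active p h), zero_mul]

theorem load_le (p : G.Profile) (e : Fin m) : G.load p e ≤ n :=
  (Finset.card_filter_le _ _).trans (by simp)

/-- The first bound keeps the selection indicator, whose expectation cancels one factor `(y e)⁻¹`.
The second is the crude uniform bound, used to verify integrability. -/
theorem costEstimate_sq_le (i : Fin n) (p : G.Profile) {y : EuclideanSpace ℝ (Fin m)} {B : ℝ}
    (hy : ∀ e ∈ G.active i, 0 < y e ∧ (y e)⁻¹ ≤ B) (e : Fin m) :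
    G.costEstimate i p y e ^ 2 ≤
      (if e ∈ (p i).1 then (1 : ℝ) else 0) * (G.cMax ^ 2 * (y e)⁻¹ ^ 2) ∧
    G.costEstimate i p y e ^ 2 ≤ G.cMax ^ 2 * B ^ 2 := by
  have hc := G.cost_mem e (load_le p e)
  by_cases he : e ∈ (p i).1
  · obtain ⟨h1, h2⟩ := hy e (mem_active p he)
    have h3 : 0 ≤ (y e)⁻¹ := inv_nonneg.2 h1.le
    rw [costEstimate_apply, if_pos he, if_pos he, one_mul, mul_pow]
    have h4 : G.cost e (G.load p e) ^ 2 ≤ G.cMax ^ 2 := pow_le_pow_left₀ hc.1 hc.2 2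
    have h5 : (y e)⁻¹ ^ 2 ≤ B ^ 2 := pow_le_pow_left₀ h3 h2 2
    exact ⟨by gcongr, by gcongr⟩
  · rw [costEstimate_apply, if_neg he]
    simp only [zero_mul, ne_eq, OfNat.ofNat_ne_zero, not_false_eq_true, zero_pow, he, if_false]
    exact ⟨le_rfl, by positivity⟩

/-- Selection has probability `x i e`, which cancels one of the two inverse factors; hence `B`
instead of `B ^ 2`. -/
theorem prodExp_costEstimate_sq_le (h : G.Represents π x) (i : Fin n) {B : ℝ} (hB : 0 ≤ B)
    (hx : ∀ e ∈ G.active i, 0 < x i e ∧ (x i e)⁻¹ ≤ B) (e : Fin m) :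
    prodExp π (fun p => G.costEstimate i p (x i) e ^ 2) ≤ G.cMax ^ 2 * B := by
  by_cases he : e ∈ G.active i
  · obtain ⟨h1, h2⟩ := hx e he
    refine (prodExp_mono (fun j => (h j).1.1) fun p =>
      (costEstimate_sq_le i p hx e).1).trans ?_
    rw [prodExp_mul_const, prodExp_used h]
    have : x i e * (G.cMax ^ 2 * (x i e)⁻¹ ^ 2) = G.cMax ^ 2 * (x i e)⁻¹ := by
      field_simp
    rw [this]
    gcongr
  · have : ∀ p : G.Profile, G.costEstimate i p (x i) e ^ 2 = 0 := fun p => by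
      rw [costEstimate_of_notMem i p _ he]; ring
    simp only [this]
    rw [prodExp_const fun j => (h j).1.2]
    positivity

/-! ### Deviation gains and the equilibrium gap -/

/-- The first-order improvement of agent `i` by deviating to the pure strategy `s`. -/
def deviationGain (G : CongestionGame n m) (x : Fin n → EuclideanSpace ℝ (Fin m)) (i : Fin n)
    (s : Finset (Fin m)) : ℝ :=
  ∑ e, G.marginal x i e * (x i e - incidence s e)

/-- The largest gain of any agent by a deviation. -/
def nashGap (G : CongestionGame n m) (x : Fin n → EuclideanSpace ℝ (Fin m)) : ℝ :=
  ⨆ k : Σ i : Fin n, {s : Finset (Fin m) // s ∈ G.strat i}, max 0 (G.deviationGain x k.1 k.2.1)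

theorem nashGap_nonneg : 0 ≤ G.nashGap x := Real.iSup_nonneg fun _ => le_max_left _ _

theorem deviationGain_le_nashGap (i : Fin n) {s : Finset (Fin m)} (hs : s ∈ G.strat i) :
    G.deviationGain x i s ≤ G.nashGap x :=
  (le_max_right _ _).trans (le_ciSup (f := fun k : Σ i : Fin n,
    {s : Finset (Fin m) // s ∈ G.strat i} => max 0 (G.deviationGain x k.1 k.2.1))
    (Set.finite_range _).bddAbove ⟨i, s, hs⟩)

theorem nashGap_le {η : ℝ} (hη : 0 ≤ η)
    (h : ∀ i, ∀ s ∈ G.strat i, G.deviationGain x i s ≤ η) : G.nashGap x ≤ η :=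
  Real.iSup_le (fun k => max_le hη (h _ _ k.2.2)) hη

theorem marginal_update (i : Fin n) (y : EuclideanSpace ℝ (Fin m)) (e : Fin m) :
    G.marginal (Function.update x i y) i e = G.marginal x i e := by
  have : (fun j => Function.update x i y j e) = Function.update (fun j => x j e) i (y e) := by
    funext j
    by_cases hj : j = i
    · subst hj; simp
    · simp [hj]
  rw [marginal, this, marginalCost_update, marginal]

theorem Represents.update (h : G.Represents π x) (i : Fin n)
    {q : {s : Finset (Fin m) // s ∈ G.strat i} → ℝ} (hq : q ∈ stdSimplex ℝ _) :
    G.Represents (Function.update π i q) (Function.update x i (G.usage i q)) := by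
  intro j
  by_cases hj : j = i
  · subst hj; simpa using hq
  · simpa [hj] using h j

/-- The marginals seen by agent `i` do not depend on its own strategy, so the cost difference for a
deviation `q` is exactly the `q`-average of the gains of pure deviations. -/
theorem isApproxMixedNE_of_nashGap_le (h : G.Represents π x) {η : ℝ} (hη : G.nashGap x ≤ η) :
    G.IsApproxMixedNE η π := by
  refine ⟨fun i => (h i).1, fun i q hq => ?_⟩
  rw [expectedCost_eq h, expectedCost_eq (h.update i hq)]
  simp only [marginal_update, Function.update_self]
  have h1 : ∑ s, q s * G.deviationGain x i s.1 ≤ η := by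
    calc ∑ s, q s * G.deviationGain x i s.1 ≤ ∑ s, q s * η :=
          Finset.sum_le_sum fun s _ => mul_le_mul_of_nonneg_left
            ((deviationGain_le_nashGap i s.2).trans hη) (hq.1 s)
      _ = η := by rw [← Finset.sum_mul, hq.2, one_mul]
  have h2 : ∑ s, q s * G.deviationGain x i s.1 =
      ∑ e, x i e * G.marginal x i e - ∑ e, G.usage i q e * G.marginal x i e := by
    simp only [deviationGain, Finset.mul_sum]
    rw [Finset.sum_comm, ← Finset.sum_sub_distrib]
    refine Finset.sum_congr rfl fun e _ => ?_
    have hu : G.usage i q e = ∑ s, q s * incidence s.1 e := by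
      simp [usage, incidence]
    rw [hu]
    calc ∑ s, q s * (G.marginal x i e * (x i e - incidence s.1 e))
        = ∑ s, (q s * (x i e * G.marginal x i e) - q s * incidence s.1 e * G.marginal x i e) :=
          Finset.sum_congr rfl fun s _ => by ring
      _ = _ := by rw [Finset.sum_sub_distrib, ← Finset.sum_mul, ← Finset.sum_mul, hq.2, one_mul]
  linarith

/-! ### Geometry of the description polytopes -/

section Polytope

theorem incidence_apply (s : Finset (Fin m)) (e : Fin m) :
    incidence s e = if e ∈ s then 1 else 0 := rfl

variable {i : Fin n} {y : EuclideanSpace ℝ (Fin m)}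

theorem incidence_mem_polytope {s : Finset (Fin m)} (hs : s ∈ G.strat i) :
    incidence s ∈ G.polytope i :=
  subset_convexHull ℝ _ ⟨s, hs, rfl⟩

theorem convex_polytope : Convex ℝ (G.polytope i) := convex_convexHull ℝ _

theorem coord_mem_of_mem_polytope (hy : y ∈ G.polytope i) (e : Fin m) :
    y e ∈ Set.Icc (0 : ℝ) 1 := by
  have hconv : Convex ℝ {y : EuclideanSpace ℝ (Fin m) | y e ∈ Set.Icc (0 : ℝ) 1} := by
    intro u hu v hv a b ha hb hab
    have := convex_Icc (0 : ℝ) 1 hu hv ha hb hab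
    simpa using this
  refine convexHull_min ?_ hconv hy
  rintro _ ⟨s, _, rfl⟩
  by_cases he : e ∈ s <;> simp [incidence_apply, he]

theorem coord_eq_zero_of_mem_polytope (hy : y ∈ G.polytope i) {e : Fin m}
    (he : e ∉ G.active i) : y e = 0 := by
  have hconv : Convex ℝ {y : EuclideanSpace ℝ (Fin m) | y e = 0} := by
    intro u hu v hv a b ha hb hab
    simp only [Set.mem_ofPred_eq] at hu hv ⊢
    simp [hu, hv]
  refine convexHull_min ?_ hconv hy
  rintro _ ⟨s, hs, rfl⟩
  have : e ∉ s := fun h => he (by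
    simp only [active, Finset.mem_filter, Finset.mem_univ, true_and]
    exact ⟨s, hs, h⟩)
  simp [incidence_apply, this]

theorem convex_boundedAway {μ : ℝ} : Convex ℝ (G.boundedAway i μ) := by
  intro u hu v hv a b ha hb hab
  refine ⟨convex_polytope hu.1 hv.1 ha hb hab, fun e he => ?_⟩
  have h1 := mul_le_mul_of_nonneg_left (hu.2 e he) ha
  have h2 := mul_le_mul_of_nonneg_left (hv.2 e he) hb
  have h3 : μ = a * μ + b * μ := by rw [← add_mul, hab, one_mul]
  simp only [PiLp.add_apply, PiLp.smul_apply, smul_eq_mul]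
  linarith

theorem boundedAway_anti {μ ν : ℝ} (h : ν ≤ μ) : G.boundedAway i μ ⊆ G.boundedAway i ν :=
  fun _ hx => ⟨hx.1, fun e he => h.trans (hx.2 e he)⟩

theorem isCompact_boundedAway {μ : ℝ} : IsCompact (G.boundedAway i μ) := by
  have h1 : IsCompact (G.polytope i) := by
    have h : (incidence '' {s : Finset (Fin m) | s ∈ G.strat i}).Finite :=
      (G.strat i).finite_toSet.image incidence
    exact h.isCompact_convexHull ℝ
  have h2 : IsClosed {x : EuclideanSpace ℝ (Fin m) | ∀ e ∈ G.active i, μ ≤ x e} := by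
    simp only [Set.ofPred_forall]
    refine isClosed_iInter fun e => isClosed_iInter fun _ => ?_
    exact isClosed_le continuous_const (by fun_prop)
  exact h1.inter_right h2

/-- For each active resource choose a strategy containing it. The uniform average of these choices
is at least `1 / k` on all `k` active resources, so mixing it into `incidence s` with weight `μ * k`
reaches the level `μ`. No coordinate then moves by more than `μ * k`. -/
theorem exists_mem_boundedAway_near {s : Finset (Fin m)} (hs : s ∈ G.strat i) {σ : ℝ}
    (hσ : 0 ≤ σ) : ∃ y ∈ G.boundedAway i (min (1 / ((G.active i).card : ℝ)) σ),
      ∀ e, |y e - incidence s e| ≤ σ * m := by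
  rcases (G.active i).eq_empty_or_nonempty with h0 | hne
  · refine ⟨incidence s, ⟨incidence_mem_polytope hs, by simp [h0]⟩, fun e => ?_⟩
    simp only [sub_self, abs_zero]
    positivity
  set k : ℝ := ((G.active i).card : ℝ) with hk
  have hkpos : 0 < k := by simpa [hk] using hne
  have hkm : k ≤ m := by
    have := Finset.card_le_univ (G.active i)
    rw [Fintype.card_fin] at this
    rw [hk]
    exact_mod_cast this
  have hex : ∀ e ∈ G.active i, ∃ s ∈ G.strat i, e ∈ s := fun e he => by
    simpa [active] using he
  choose! f hf1 hf2 using hex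
  set z : EuclideanSpace ℝ (Fin m) := ∑ e ∈ G.active i, (1 / k) • incidence (f e) with hz
  have hzmem : z ∈ G.polytope i := by
    refine convex_polytope.sum_mem (fun _ _ => by positivity) ?_
      fun e he => incidence_mem_polytope (hf1 e he)
    simp only [Finset.sum_const, nsmul_eq_mul]
    field_simp
    simp [hk]
  have hzle : ∀ e ∈ G.active i, 1 / k ≤ z e := by
    intro e he
    have h1 : z e = ∑ e' ∈ G.active i, (1 / k) * incidence (f e') e := by
      simp [hz]
    rw [h1]
    have h2 : (1 / k) * incidence (f e) e = 1 / k := by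
      simp [incidence_apply, hf2 e he]
    refine h2.symm.le.trans ?_
    refine Finset.single_le_sum (f := fun e' => (1 / k) * incidence (f e') e) ?_ he
    intro e' _
    have : 0 ≤ incidence (f e') e := by rw [incidence_apply]; split_ifs <;> norm_num
    positivity
  set μ := min (1 / k) σ with hμ
  have hμ0 : 0 ≤ μ := le_min (by positivity) hσ
  have hμk : μ * k ≤ 1 := by
    calc μ * k ≤ 1 / k * k := by gcongr; exact min_le_left _ _
      _ = 1 := by field_simp
  have hμm : μ * k ≤ σ * m := by
    have : μ ≤ σ := min_le_right _ _
    gcongr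
  refine ⟨(1 - μ * k) • incidence s + (μ * k) • z, ⟨?_, fun e he => ?_⟩, fun e => ?_⟩
  · exact convex_polytope (incidence_mem_polytope hs) hzmem (by linarith) (by positivity) (by ring)
  · have h1 := hzle e he
    have h2 : 0 ≤ incidence s e := by rw [incidence_apply]; split_ifs <;> norm_num
    simp only [PiLp.add_apply, PiLp.smul_apply, smul_eq_mul]
    have h3 : μ = μ * k * (1 / k) := by field_simp
    have h4 : μ * k * (1 / k) ≤ μ * k * z e := by gcongr
    have h5 : 0 ≤ (1 - μ * k) * incidence s e := mul_nonneg (by linarith) h2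
    linarith
  · have h1 := coord_mem_of_mem_polytope hzmem e
    have h2 := coord_mem_of_mem_polytope (incidence_mem_polytope hs) e
    simp only [PiLp.add_apply, PiLp.smul_apply, smul_eq_mul]
    have h3 : (1 - μ * k) * incidence s e + μ * k * z e - incidence s e =
        μ * k * (z e - incidence s e) := by ring
    rw [h3, abs_mul, abs_of_nonneg (by positivity : 0 ≤ μ * k)]
    have h4 : |z e - incidence s e| ≤ 1 := by
      rw [abs_le]; constructor <;> linarith [h1.1, h1.2, h2.1, h2.2]
    calc μ * k * |z e - incidence s e| ≤ μ * k * 1 := by gcongr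
      _ ≤ σ * m := by linarith

end Polytope

end CongestionGame

/-! ### Moreau envelope: descent in one round and control of the gap -/

theorem IsCompact.exists_eq_sInf_image {α : Type*} [TopologicalSpace α] {K : Set α}
    (hK : IsCompact K) (hne : K.Nonempty) {f : α → ℝ} (hf : Continuous f) :
    ∃ y ∈ K, sInf (f '' K) = f y := hK.exists_sInf_image_eq hne hf.continuousOn

theorem prodExp_sub_mul_sq {ι : Type*} [Fintype ι] [DecidableEq ι] {A : ι → Type*}
    [∀ i, Fintype (A i)] {w : ∀ j, A j → ℝ} (hw : ∀ j, ∑ a, w j a = 1)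
    (g : (∀ j, A j) → ℝ) (d γ : ℝ) :
    prodExp w (fun p => (d - γ * g p) ^ 2) =
      d ^ 2 - 2 * γ * (d * prodExp w g) + γ ^ 2 * prodExp w fun p => g p ^ 2 := by
  rw [← prodExp_const hw (d ^ 2)]
  unfold prodExp
  simp only [Finset.mul_sum]
  rw [← Finset.sum_sub_distrib, ← Finset.sum_add_distrib]
  exact Finset.sum_congr rfl fun p _ => by ring

namespace CongestionGame

variable {n m : ℕ} (G : CongestionGame n m)

/-- The squared Euclidean distance of two families of points. -/
def sqDist (x y : Fin n → EuclideanSpace ℝ (Fin m)) : ℝ :=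
  ∑ i, ∑ e, (x i e - y i e) ^ 2

/-- The product of the bounded-away polytopes. -/
def domain (μ : Fin n → ℝ) : Set (Fin n → EuclideanSpace ℝ (Fin m)) :=
  Set.univ.pi fun i => G.boundedAway i (μ i)

/-- The Moreau envelope of the potential on the product of the bounded-away polytopes. -/
def envelope (μ : Fin n → ℝ) (z : Fin n → EuclideanSpace ℝ (Fin m)) : ℝ :=
  sInf ((fun y => G.potential y + 2 * n * G.cMax * sqDist z y) '' G.domain μ)

variable {G}

theorem sqDist_nonneg (x y : Fin n → EuclideanSpace ℝ (Fin m)) : 0 ≤ sqDist x y :=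
  Finset.sum_nonneg fun _ _ => Finset.sum_nonneg fun _ _ => sq_nonneg _

theorem sqDist_eq_norm (x y : Fin n → EuclideanSpace ℝ (Fin m)) :
    sqDist x y = ∑ i, ‖x i - y i‖ ^ 2 := by
  simp [sqDist, EuclideanSpace.real_norm_sq_eq]

theorem sqDist_self (x : Fin n → EuclideanSpace ℝ (Fin m)) : sqDist x x = 0 := by
  simp [sqDist]

theorem continuous_prodExp_bern {α ι : Type*} [TopologicalSpace α] [Fintype ι] [DecidableEq ι]
    {z : α → ι → ℝ} (hz : Continuous z) (g : (ι → Bool) → ℝ) :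
    Continuous fun a => prodExp (bern (z a)) g := by
  unfold prodExp
  refine continuous_finsetSum _ fun b _ => Continuous.mul
    (continuous_finsetProd _ fun j _ => ?_) continuous_const
  have := (continuous_apply j).comp hz
  cases b j
  · exact continuous_const.sub this
  · exact this

theorem continuous_column (e : Fin m) :
    Continuous fun (x : Fin n → EuclideanSpace ℝ (Fin m)) (j : Fin n) => x j e := by
  fun_prop

theorem continuous_potential : Continuous G.potential :=
  continuous_finsetSum _ fun e _ => continuous_prodExp_bern (continuous_column e) _

theorem continuous_marginal (i : Fin n) (e : Fin m) : Continuous fun x => G.marginal x i e :=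
  continuous_prodExp_bern (continuous_column e) _

theorem isCompact_domain (μ : Fin n → ℝ) : IsCompact (G.domain μ) :=
  isCompact_univ_pi fun _ => isCompact_boundedAway

theorem continuous_objective (z : Fin n → EuclideanSpace ℝ (Fin m)) :
    Continuous fun y => G.potential y + 2 * n * G.cMax * sqDist z y := by
  have := G.continuous_potential
  unfold sqDist
  fun_prop

theorem continuous_envelope (μ : Fin n → ℝ) : Continuous (G.envelope μ) := by
  refine (isCompact_domain μ).continuous_sInf ?_
  have := G.continuous_potential
  unfold Function.HasUncurry.uncurry Function.hasUncurryInduction sqDist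
  simp only [Function.HasUncurry.uncurry, id]
  fun_prop

theorem envelope_le {μ : Fin n → ℝ} {y : Fin n → EuclideanSpace ℝ (Fin m)} (hy : y ∈ G.domain μ)
    (z : Fin n → EuclideanSpace ℝ (Fin m)) :
    G.envelope μ z ≤ G.potential y + 2 * n * G.cMax * sqDist z y :=
  csInf_le ((isCompact_domain μ).image (continuous_objective z)).bddBelow ⟨y, hy, rfl⟩

theorem exists_envelope_eq {μ : Fin n → ℝ} (hne : (G.domain μ).Nonempty)
    (z : Fin n → EuclideanSpace ℝ (Fin m)) :
    ∃ y ∈ G.domain μ, G.envelope μ z = G.potential y + 2 * n * G.cMax * sqDist z y :=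
  (isCompact_domain μ).exists_eq_sInf_image hne (continuous_objective z)

/-- All coordinates are probabilities. -/
def InCube (x : Fin n → EuclideanSpace ℝ (Fin m)) : Prop :=
  ∀ i e, x i e ∈ Set.Icc (0 : ℝ) 1

theorem inCube_of_mem_domain {μ : Fin n → ℝ} {y : Fin n → EuclideanSpace ℝ (Fin m)}
    (hy : y ∈ G.domain μ) : InCube y :=
  fun i e => coord_mem_of_mem_polytope (hy i trivial).1 e

theorem potential_mem {x : Fin n → EuclideanSpace ℝ (Fin m)} (hx : InCube x) :
    G.potential x ∈ Set.Icc 0 (n * m * G.cMax) := by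
  have h : ∀ e, resourcePotential (G.cost e) (fun j => x j e) ∈ Set.Icc 0 (n * G.cMax) := by
    intro e
    simpa using resourcePotential_mem G.cMax_nonneg (G.cost_mem' e) fun j => hx j e
  refine ⟨Finset.sum_nonneg fun e _ => (h e).1, ?_⟩
  calc G.potential x ≤ ∑ _e : Fin m, n * G.cMax := Finset.sum_le_sum fun e _ => (h e).2
    _ = n * m * G.cMax := by simp; ring

theorem marginal_mem {x : Fin n → EuclideanSpace ℝ (Fin m)} (hx : InCube x) (i : Fin n)
    (e : Fin m) : G.marginal x i e ∈ Set.Icc 0 G.cMax :=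
  marginalCost_mem (G.cost_mem' e) (fun j => hx j e) i

theorem envelope_nonneg {μ : Fin n → ℝ} (hne : (G.domain μ).Nonempty)
    (z : Fin n → EuclideanSpace ℝ (Fin m)) : 0 ≤ G.envelope μ z := by
  obtain ⟨y, hy, h⟩ := exists_envelope_eq hne z
  have := G.cMax_nonneg
  have := sqDist_nonneg z y
  rw [h]
  exact add_nonneg (potential_mem (inCube_of_mem_domain hy)).1 (by positivity)

theorem envelope_le_potential {μ : Fin n → ℝ} {x : Fin n → EuclideanSpace ℝ (Fin m)}
    (hx : x ∈ G.domain μ) : G.envelope μ x ≤ G.potential x := by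
  simpa [sqDist_self] using envelope_le hx x

/-- Summing `resourcePotential_lower` over the resources gives weak convexity, the substitute for
convexity in the descent argument. -/
theorem potential_lower {x y : Fin n → EuclideanSpace ℝ (Fin m)} (hx : InCube x)
    (hy : InCube y) :
    G.potential x - ∑ i, ∑ e, (x i e - y i e) * G.marginal x i e - n * G.cMax * sqDist x y ≤
      G.potential y := by
  have h := Finset.sum_le_sum fun e (_ : e ∈ Finset.univ) =>
    resourcePotential_lower G.cMax_nonneg (G.cost_mem' e) (fun j => hy j e) (fun j => hx j e)
  rw [Finset.sum_sub_distrib, Finset.sum_add_distrib, ← Finset.mul_sum, Finset.sum_comm,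
    Finset.sum_comm (f := fun e i => (y i e - x i e) ^ 2)] at h
  have h1 : ∑ i, ∑ e, (y i e - x i e) * marginalCost (G.cost e) (fun j => x j e) i =
      - ∑ i, ∑ e, (x i e - y i e) * G.marginal x i e := by
    simp only [← Finset.sum_neg_distrib]
    refine Finset.sum_congr rfl fun i _ => Finset.sum_congr rfl fun e _ => ?_
    rw [marginal]; ring
  have h2 : ∑ i, ∑ e, (y i e - x i e) ^ 2 = sqDist x y := by
    refine Finset.sum_congr rfl fun i _ => Finset.sum_congr rfl fun e _ => ?_
    ring
  rw [h1, h2, Fintype.card_fin] at h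
  unfold potential
  linarith

theorem norm_sq_sub_le_of_isProjection {K : Set (EuclideanSpace ℝ (Fin m))} (hK : Convex ℝ K)
    {z w v : EuclideanSpace ℝ (Fin m)} (h : IsProjection K z w) (hv : v ∈ K) :
    ‖w - v‖ ^ 2 ≤ ‖z - v‖ ^ 2 := by
  have h1 : ‖z - w‖ = ⨅ u : K, ‖z - u‖ := by
    have : Nonempty K := ⟨⟨w, h.1⟩⟩
    refine le_antisymm (le_ciInf fun u => h.2 u u.2) ?_
    exact ciInf_le ⟨0, by rintro _ ⟨u, rfl⟩; exact norm_nonneg _⟩ (⟨w, h.1⟩ : K)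
  have h2 := (norm_eq_iInf_iff_real_inner_le_zero hK h.1).1 h1 v hv
  have h3 : z - v = (z - w) - (v - w) := by abel
  have h4 : ‖w - v‖ = ‖v - w‖ := norm_sub_rev _ _
  rw [h3, h4, norm_sub_sq_real (z - w)]
  nlinarith [sq_nonneg ‖z - w‖]

/-- The minimizer `y` for the smaller domain is still admissible for the larger one, and projection
onto a convex set containing `y` does not increase the distance to `y`. -/
theorem envelope_projection_le {μ μ' : Fin n → ℝ} (hμ : ∀ i, μ' i ≤ μ i)
    (hne : (G.domain μ).Nonempty) {z w : Fin n → EuclideanSpace ℝ (Fin m)}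
    (h : ∀ i, IsProjection (G.boundedAway i (μ' i)) (z i) (w i)) :
    G.envelope μ' w ≤ G.envelope μ z := by
  obtain ⟨y, hy, hyeq⟩ := exists_envelope_eq hne z
  have hy' : y ∈ G.domain μ' := fun i hi => boundedAway_anti (hμ i) (hy i hi)
  have := G.cMax_nonneg
  refine (envelope_le hy' w).trans ?_
  rw [hyeq, sqDist_eq_norm, sqDist_eq_norm]
  gcongr with i
  have := norm_sq_sub_le_of_isProjection convex_boundedAway (h i) (hy' i trivial)
  exact le_of_sq_le_sq this (norm_nonneg _)

/-- The minimizer `x'` at `x` is used as a competitor after every outcome of the step, and the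
squared distance is expanded. Comparing the envelope with the potential at `x` gives `potential x -
potential x' ≥ 2 * n * cMax * sqDist x x'`; weak convexity costs half of this, and the rest bounds
the inner product of gradient and displacement from below. -/
theorem prodExp_envelope_le {π : G.MixedProfile} {x x' : Fin n → EuclideanSpace ℝ (Fin m)}
    (hπ : G.Represents π x) {μ : Fin n → ℝ} (hx : x ∈ G.domain μ) (hx' : x' ∈ G.domain μ)
    (hmin : G.envelope μ x = G.potential x' + 2 * n * G.cMax * sqDist x x')
    {B : ℝ} (hB : 0 ≤ B) (hxB : ∀ i, ∀ e ∈ G.active i, 0 < x i e ∧ (x i e)⁻¹ ≤ B)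
    {γ : ℝ} (hγ : 0 ≤ γ) :
    prodExp π (fun a => G.envelope μ fun i => x i - γ • G.costEstimate i a (x i)) ≤
      G.envelope μ x - 4 * n ^ 2 * G.cMax ^ 2 * γ * sqDist x x' +
        2 * n ^ 2 * m * G.cMax ^ 3 * γ ^ 2 * B := by
  have hc := G.cMax_nonneg
  have hw1 : ∀ j, ∑ a, π j a = 1 := fun j => (hπ j).1.2
  have hstep : prodExp π (fun a => G.envelope μ fun i => x i - γ • G.costEstimate i a (x i)) ≤
      prodExp π (fun a => ∑ i, ∑ e, (x i e - x' i e - γ * G.costEstimate i a (x i) e) ^ 2) *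
        (2 * n * G.cMax) + G.potential x' := by
    rw [← prodExp_mul_const, ← prodExp_const hw1 (G.potential x')]
    unfold prodExp
    rw [← Finset.sum_add_distrib]
    refine Finset.sum_le_sum fun a _ => ?_
    rw [← mul_add]
    refine mul_le_mul_of_nonneg_left ?_ (Finset.prod_nonneg fun j _ => (hπ j).1.1 _)
    refine (envelope_le hx' _).trans (le_of_eq ?_)
    rw [add_comm, mul_comm]
    congr 2
    refine Finset.sum_congr rfl fun i _ => Finset.sum_congr rfl fun e _ => ?_
    simp only [PiLp.sub_apply, PiLp.smul_apply, smul_eq_mul]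
    ring
  have hterm : ∀ i e, prodExp π
      (fun a => (x i e - x' i e - γ * G.costEstimate i a (x i) e) ^ 2) ≤
      (x i e - x' i e) ^ 2 - 2 * γ * ((x i e - x' i e) * G.marginal x i e) +
        γ ^ 2 * (G.cMax ^ 2 * B) := by
    intro i e
    rw [prodExp_sub_mul_sq hw1]
    have h1 := mul_le_mul_of_nonneg_left (prodExp_costEstimate_sq_le hπ i hB (hxB i) e)
      (sq_nonneg γ)
    -- On inactive resources the estimate vanishes and may differ from the marginal, but both points
    -- have coordinate zero there.
    have h2 : (x i e - x' i e) * prodExp π (fun p => G.costEstimate i p (x i) e) =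
        (x i e - x' i e) * G.marginal x i e := by
      by_cases he : e ∈ G.active i
      · rw [prodExp_costEstimate hπ i e (hxB i e he).1.ne']
      · rw [coord_eq_zero_of_mem_polytope (hx i trivial).1 he,
          coord_eq_zero_of_mem_polytope (hx' i trivial).1 he]
        simp
    rw [h2]
    linarith
  have hsum : prodExp π (fun a => ∑ i, ∑ e,
      (x i e - x' i e - γ * G.costEstimate i a (x i) e) ^ 2) ≤
      sqDist x x' - 2 * γ * ∑ i, ∑ e, (x i e - x' i e) * G.marginal x i e +
        n * m * (γ ^ 2 * (G.cMax ^ 2 * B)) := by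
    rw [prodExp_finset_sum]
    simp only [prodExp_finset_sum]
    refine (Finset.sum_le_sum fun i _ => Finset.sum_le_sum fun e _ => hterm i e).trans
      (le_of_eq ?_)
    simp only [Finset.sum_add_distrib, Finset.sum_sub_distrib, ← Finset.mul_sum,
      Finset.sum_const, Finset.card_univ, Fintype.card_fin, nsmul_eq_mul, sqDist]
    ring
  have hlow := potential_lower (G := G) (inCube_of_mem_domain hx) (inCube_of_mem_domain hx')
  have hup := envelope_le_potential hx
  have hd : n * G.cMax * sqDist x x' ≤ ∑ i, ∑ e, (x i e - x' i e) * G.marginal x i e := by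
    linarith
  have h3 : 2 * γ * (n * G.cMax * sqDist x x') ≤
      2 * γ * ∑ i, ∑ e, (x i e - x' i e) * G.marginal x i e := by gcongr
  have h4 : prodExp π (fun a => ∑ i, ∑ e,
      (x i e - x' i e - γ * G.costEstimate i a (x i) e) ^ 2) * (2 * n * G.cMax) ≤
      (sqDist x x' - 2 * γ * (n * G.cMax * sqDist x x') +
        n * m * (γ ^ 2 * (G.cMax ^ 2 * B))) * (2 * n * G.cMax) := by
    gcongr
    linarith
  rw [hmin]
  calc _ ≤ _ := hstep
    _ ≤ _ := add_le_add h4 le_rfl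
    _ = _ := by ring

/-- First-order optimality of the minimizer in the block of agent `i`. -/
theorem envelope_optimality {x x' : Fin n → EuclideanSpace ℝ (Fin m)} {μ : Fin n → ℝ}
    (hx' : x' ∈ G.domain μ)
    (hmin : G.envelope μ x = G.potential x' + 2 * n * G.cMax * sqDist x x')
    (i : Fin n) {y : EuclideanSpace ℝ (Fin m)} (hy : y ∈ G.boundedAway i (μ i)) :
    ∑ e, G.marginal x' i e * (x' i e - y e) ≤
      4 * n * G.cMax * ∑ e, (x i e - x' i e) * (x' i e - y e) := by
  set Q := ∑ e, (y e - x' i e) ^ 2 with hQ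
  have key : ∀ θ : ℝ, 0 < θ → θ ≤ 1 →
      0 ≤ ∑ e, G.marginal x' i e * (y e - x' i e) +
        2 * n * G.cMax * (-2 * (∑ e, (x i e - x' i e) * (y e - x' i e)) + θ * Q) := by
    intro θ h0 h1
    set v : EuclideanSpace ℝ (Fin m) := (1 - θ) • x' i + θ • y with hv
    have hve : ∀ e, v e = x' i e + θ * (y e - x' i e) := by
      intro e
      simp only [hv, PiLp.add_apply, PiLp.smul_apply, smul_eq_mul]
      ring
    have hmem : Function.update x' i v ∈ G.domain μ := by
      intro j _
      by_cases hj : j = i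
      · subst hj
        simp only [Function.update_self]
        exact convex_boundedAway (hx' j trivial) hy (by linarith) h0.le (by ring)
      · simp only [ne_eq, hj, not_false_eq_true, Function.update_of_ne]
        exact hx' j trivial
    -- Only the block of agent `i` moves, so the potential is exactly affine along the segment,
    -- without a second-order term.
    have hpot : G.potential (Function.update x' i v) = G.potential x' +
        θ * ∑ e, G.marginal x' i e * (y e - x' i e) := by
      unfold potential
      rw [Finset.mul_sum, ← Finset.sum_add_distrib]
      refine Finset.sum_congr rfl fun e _ => ?_
      have : (fun j => Function.update x' i v j e) =
          Function.update (fun j => x' j e) i (v e) := by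
        funext j
        by_cases hj : j = i
        · subst hj; simp
        · simp [hj]
      rw [this, resourcePotential_update, hve, marginal]
      ring
    have hdist : sqDist x (Function.update x' i v) = sqDist x x' +
        θ * (-2 * (∑ e, (x i e - x' i e) * (y e - x' i e)) + θ * Q) := by
      unfold sqDist
      rw [← Finset.add_sum_erase _ _ (Finset.mem_univ i),
        ← Finset.add_sum_erase (a := i) _ (fun i => ∑ e, (x i e - x' i e) ^ 2)
          (Finset.mem_univ i)]
      have h2 : ∀ j ∈ Finset.univ.erase i, ∑ e, (x j e - Function.update x' i v j e) ^ 2 =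
          ∑ e, (x j e - x' j e) ^ 2 := by
        intro j hj
        rw [Function.update_of_ne (Finset.ne_of_mem_erase hj)]
      rw [Finset.sum_congr rfl h2]
      have h3 : ∑ e, (x i e - Function.update x' i v i e) ^ 2 = ∑ e, (x i e - x' i e) ^ 2 +
          θ * (-2 * (∑ e, (x i e - x' i e) * (y e - x' i e)) + θ * Q) := by
        rw [hQ, Function.update_self]
        simp only [Finset.mul_sum, ← Finset.sum_add_distrib]
        refine Finset.sum_congr rfl fun e _ => ?_
        rw [hve]
        ring
      rw [h3]
      ring
    have h := envelope_le hmem x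
    rw [hmin, hpot, hdist] at h
    have h5 : 0 ≤ θ * (∑ e, G.marginal x' i e * (y e - x' i e) +
        2 * n * G.cMax * (-2 * (∑ e, (x i e - x' i e) * (y e - x' i e)) + θ * Q)) := by
      linarith
    exact nonneg_of_mul_nonneg_right h5 h0
  -- The factor `θ` has been divided out; letting it tend to zero removes the quadratic term.
  have hlim : 0 ≤ ∑ e, G.marginal x' i e * (y e - x' i e) +
      2 * n * G.cMax * (-2 * (∑ e, (x i e - x' i e) * (y e - x' i e)) + 0 * Q) := by
    have hcont : Continuous fun θ : ℝ => ∑ e, G.marginal x' i e * (y e - x' i e) +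
      2 * n * G.cMax * (-2 * (∑ e, (x i e - x' i e) * (y e - x' i e)) + θ * Q) := by fun_prop
    refine ge_of_tendsto ((hcont.tendsto 0).mono_left (nhdsWithin_le_nhds (s := Set.Ioi 0))) ?_
    filter_upwards [Ioc_mem_nhdsGT (zero_lt_one (α := ℝ))] with θ hθ
    exact key θ hθ.1 hθ.2
  have h1 : ∑ e, G.marginal x' i e * (x' i e - y e) =
      - ∑ e, G.marginal x' i e * (y e - x' i e) := by
    rw [← Finset.sum_neg_distrib]
    exact Finset.sum_congr rfl fun e _ => by ring
  have h2 : ∑ e, (x i e - x' i e) * (x' i e - y e) =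
      - ∑ e, (x i e - x' i e) * (y e - x' i e) := by
    rw [← Finset.sum_neg_distrib]
    exact Finset.sum_congr rfl fun e _ => by ring
  rw [h1, h2]
  linarith

/-- A deviation to `s` is compared with a nearby admissible point `y`, and the gradient at `x` with
the gradient at `x'`, where `envelope_optimality` applies. With `ρ = √(m * sqDist x x')`, moving the
point costs `cMax * ρ`, moving the gradient `n * cMax * ρ`, and optimality `4 * n * cMax * ρ`, at
most `6 * n * cMax * ρ` in total. Replacing `s` by `y` gives the exploration bias. -/
theorem nashGap_le_of_envelope {x x' : Fin n → EuclideanSpace ℝ (Fin m)} {σ : ℝ} (hσ : 0 ≤ σ)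
    {μ : Fin n → ℝ} (hμ : ∀ i, μ i = min (1 / ((G.active i).card : ℝ)) σ)
    (hx : x ∈ G.domain μ) (hx' : x' ∈ G.domain μ)
    (hmin : G.envelope μ x = G.potential x' + 2 * n * G.cMax * sqDist x x') :
    G.nashGap x ≤ 6 * n * G.cMax * √(m * sqDist x x') + m ^ 2 * G.cMax * σ := by
  have hc := G.cMax_nonneg
  have hcx := inCube_of_mem_domain hx
  have hcx' := inCube_of_mem_domain hx'
  have hr := sqDist_nonneg x x'
  refine nashGap_le (by positivity) fun i s hs => ?_
  obtain ⟨y, hy, hys⟩ := exists_mem_boundedAway_near hs hσ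
  rw [← hμ i] at hy
  have hycube : ∀ e, y e ∈ Set.Icc (0 : ℝ) 1 := coord_mem_of_mem_polytope hy.1
  set ρ := √(m * sqDist x x') with hρ
  have hrow : ∑ e, |x i e - x' i e| ≤ ρ := by
    refine Real.le_sqrt_of_sq_le ?_
    have h1 := sq_sum_le_card_mul_sum_sq (s := Finset.univ) (f := fun e => |x i e - x' i e|)
    simp only [sq_abs, Finset.card_univ, Fintype.card_fin] at h1
    refine h1.trans ?_
    gcongr
    exact Finset.single_le_sum (f := fun i => ∑ e, (x i e - x' i e) ^ 2)
      (fun _ _ => Finset.sum_nonneg fun _ _ => sq_nonneg _) (Finset.mem_univ i)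
  have hall : ∑ e, ∑ j, |x j e - x' j e| ≤ n * ρ := by
    rw [Finset.sum_comm]
    have : ∀ j ∈ Finset.univ, ∑ e, |x j e - x' j e| ≤ ρ := by
      intro j _
      refine Real.le_sqrt_of_sq_le ?_
      have h1 := sq_sum_le_card_mul_sum_sq (s := Finset.univ) (f := fun e => |x j e - x' j e|)
      simp only [sq_abs, Finset.card_univ, Fintype.card_fin] at h1
      refine h1.trans ?_
      gcongr
      exact Finset.single_le_sum (f := fun i => ∑ e, (x i e - x' i e) ^ 2)
        (fun _ _ => Finset.sum_nonneg fun _ _ => sq_nonneg _) (Finset.mem_univ j)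
    simpa using Finset.sum_le_card_nsmul _ _ _ this
  have hρ0 : 0 ≤ ρ := Real.sqrt_nonneg _
  have hn1 : (1 : ℝ) ≤ n := by
    have : 0 < n := i.pos
    exact_mod_cast this
  have t1 : ∑ e, G.marginal x i e * (x i e - x' i e) ≤ G.cMax * ρ := by
    refine le_trans (Finset.sum_le_sum fun e _ => ?_)
      ((Finset.mul_sum _ _ _).symm.le.trans (mul_le_mul_of_nonneg_left hrow hc))
    have h1 := marginal_mem (G := G) hcx i e
    exact (mul_le_mul_of_nonneg_left (le_abs_self _) h1.1).trans
      (mul_le_mul_of_nonneg_right h1.2 (abs_nonneg _))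
  have t2 : ∑ e, (G.marginal x i e - G.marginal x' i e) * (x' i e - y e) ≤
      G.cMax * (n * ρ) := by
    refine le_trans (Finset.sum_le_sum fun e _ => ?_)
      ((Finset.mul_sum _ _ _).symm.le.trans (mul_le_mul_of_nonneg_left hall hc))
    have h1 := abs_marginalCost_sub_le (G.cost_mem' e) (fun j => hcx j e) (fun j => hcx' j e) i
    have h2 : |x' i e - y e| ≤ 1 := by
      rw [abs_le]; constructor <;> linarith [(hcx' i e).1, (hcx' i e).2, (hycube e).1, (hycube e).2]
    calc _ ≤ |(G.marginal x i e - G.marginal x' i e) * (x' i e - y e)| := le_abs_self _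
      _ = |G.marginal x i e - G.marginal x' i e| * |x' i e - y e| := abs_mul _ _
      _ ≤ |G.marginal x i e - G.marginal x' i e| * 1 := by gcongr
      _ ≤ _ := by rw [mul_one]; exact h1
  have t3 : ∑ e, G.marginal x' i e * (x' i e - y e) ≤ 4 * n * G.cMax * ρ := by
    refine (envelope_optimality hx' hmin i hy).trans ?_
    gcongr
    refine le_trans (Finset.sum_le_sum fun e _ => ?_) hrow
    have h2 : |x' i e - y e| ≤ 1 := by
      rw [abs_le]; constructor <;> linarith [(hcx' i e).1, (hcx' i e).2, (hycube e).1, (hycube e).2]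
    calc _ ≤ |(x i e - x' i e) * (x' i e - y e)| := le_abs_self _
      _ = |x i e - x' i e| * |x' i e - y e| := abs_mul _ _
      _ ≤ |x i e - x' i e| * 1 := by gcongr
      _ = _ := mul_one _
  have t4 : ∑ e, G.marginal x i e * (y e - incidence s e) ≤ m ^ 2 * G.cMax * σ := by
    have : ∀ e ∈ Finset.univ, G.marginal x i e * (y e - incidence s e) ≤ G.cMax * (σ * m) := by
      intro e _
      have h1 := marginal_mem (G := G) hcx i e
      calc _ ≤ G.marginal x i e * (σ * m) :=
            mul_le_mul_of_nonneg_left ((le_abs_self _).trans (hys e)) h1.1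
        _ ≤ _ := by gcongr; exact h1.2
    refine (Finset.sum_le_card_nsmul _ _ _ this).trans (le_of_eq ?_)
    simp
    ring
  have hsplit : G.deviationGain x i s = ∑ e, G.marginal x i e * (x i e - x' i e) +
      ∑ e, (G.marginal x i e - G.marginal x' i e) * (x' i e - y e) +
      ∑ e, G.marginal x' i e * (x' i e - y e) +
      ∑ e, G.marginal x i e * (y e - incidence s e) := by
    rw [deviationGain, ← Finset.sum_add_distrib, ← Finset.sum_add_distrib,
      ← Finset.sum_add_distrib]
    exact Finset.sum_congr rfl fun e _ => by ring
  rw [hsplit]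
  have : G.cMax * ρ ≤ n * (G.cMax * ρ) := le_mul_of_one_le_left (by positivity) hn1
  linarith

/-- Expected decrease of the envelope in one round, in terms of the equilibrium gap. -/
theorem envelope_decrease {π : G.MixedProfile} {x : Fin n → EuclideanSpace ℝ (Fin m)}
    (hm : 0 < m)
    (hπ : G.Represents π x) {σ : ℝ} (hσ : 0 ≤ σ)
    {μ : Fin n → ℝ} (hμ : ∀ i, μ i = min (1 / ((G.active i).card : ℝ)) σ)
    (hx : x ∈ G.domain μ)
    {B : ℝ} (hB : 0 ≤ B) (hxB : ∀ i, ∀ e ∈ G.active i, 0 < x i e ∧ (x i e)⁻¹ ≤ B)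
    {γ : ℝ} (hγ : 0 ≤ γ) :
    prodExp π (fun a => G.envelope μ fun i => x i - γ • G.costEstimate i a (x i)) +
        γ / (9 * m) * max 0 (G.nashGap x - m ^ 2 * G.cMax * σ) ^ 2 ≤
      G.envelope μ x + 2 * n ^ 2 * m * G.cMax ^ 3 * γ ^ 2 * B := by
  obtain ⟨x', hx', hmin⟩ := exists_envelope_eq ⟨x, hx⟩ x
  have h1 := prodExp_envelope_le hπ hx hx' hmin hB hxB hγ
  have h2 := nashGap_le_of_envelope hσ hμ hx hx' hmin
  have hc := G.cMax_nonneg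
  have hr := sqDist_nonneg x x'
  have hm' : (0 : ℝ) < m := by exact_mod_cast hm
  have h3 : max 0 (G.nashGap x - m ^ 2 * G.cMax * σ) ^ 2 ≤
      (6 * n * G.cMax * √(m * sqDist x x')) ^ 2 := by
    refine pow_le_pow_left₀ (le_max_left _ _) (max_le (by positivity) (by linarith)) 2
  rw [mul_pow, Real.sq_sqrt (by positivity)] at h3
  -- The normalization `9 * m` makes the squared gap bound equal to the expected decrease, since `6
  -- ^ 2 / 9 = 4`.
  have h4 : γ / (9 * m) * max 0 (G.nashGap x - m ^ 2 * G.cMax * σ) ^ 2 ≤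
      γ / (9 * m) * ((6 * n * G.cMax) ^ 2 * (m * sqDist x x')) := by gcongr
  have h5 : γ / (9 * m) * ((6 * n * G.cMax) ^ 2 * (m * sqDist x x')) =
      4 * n ^ 2 * G.cMax ^ 2 * γ * sqDist x x' := by
    field_simp
    ring
  linarith

end CongestionGame

/-! ### Conditional sampling, weighted telescoping and Markov bounds -/

/-- Splitting over the values of `p` writes the integrand as a sum of `f a` times the indicator of
`p = a`. Each `f a` is known before sampling and can be pulled out of the conditional expectation.
-/
theorem integral_sampled {Ω α : Type*} [mΩ : MeasurableSpace Ω] {P : Measure Ω}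
    [IsProbabilityMeasure P] {F : MeasurableSpace Ω} (hF : F ≤ mΩ) [Fintype α] {p : Ω → α}
    (hp : ∀ a, MeasurableSet[mΩ] {ω | p ω = a}) {w : α → Ω → ℝ}
    (hw : ∀ a, P[Set.indicator {ω | p ω = a} (fun _ => (1 : ℝ)) | F] =ᵐ[P] w a)
    {f : α → Ω → ℝ} (hf : ∀ a, Measurable[F] (f a)) {C : ℝ} (hC : ∀ a ω, |f a ω| ≤ C) :
    Integrable (fun ω => f (p ω) ω) P ∧ Integrable (fun ω => ∑ a, w a ω * f a ω) P ∧
      ∫ ω, f (p ω) ω ∂P = ∫ ω, ∑ a, w a ω * f a ω ∂P := by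
  classical
  set I : α → Ω → ℝ := fun a => Set.indicator {ω | p ω = a} (fun _ => (1 : ℝ)) with hI
  have hIint : ∀ a, Integrable (I a) P := fun a =>
    (integrable_const (1 : ℝ)).indicator (hp a)
  have hfI : ∀ a, Integrable (f a * I a) P := by
    intro a
    refine (hIint a).bdd_mul ((hf a).mono hF le_rfl).aestronglyMeasurable (c := C) ?_
    exact Filter.Eventually.of_forall fun ω => hC a ω
  have hce : ∀ a, P[f a * I a | F] =ᵐ[P] fun ω => w a ω * f a ω := by
    intro a
    have h1 := condExp_mul_of_stronglyMeasurable_left (hf a).stronglyMeasurable (hfI a) (hIint a)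
    filter_upwards [h1, hw a] with ω h1 h2
    rw [h1, Pi.mul_apply, h2, mul_comm]
  have hwint : ∀ a, Integrable (fun ω => w a ω * f a ω) P := fun a =>
    integrable_condExp.congr (hce a)
  have hsum : (fun ω => f (p ω) ω) = fun ω => ∑ a, (f a * I a) ω := by
    funext ω
    simp [hI, Set.indicator_apply]
  rw [hsum]
  refine ⟨integrable_finsetSum _ fun a _ => hfI a, integrable_finsetSum _ fun a _ => hwint a, ?_⟩
  rw [integral_finsetSum _ fun a _ => hfI a, integral_finsetSum _ fun a _ => hwint a]
  refine Finset.sum_congr rfl fun a _ => ?_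
  rw [← integral_condExp hF, integral_congr_ae (hce a)]

/-- Abel summation of a descent inequality with decreasing step sizes. -/
theorem sum_le_of_descent {V W h g D : ℕ → ℝ} {A : ℝ} {T : ℕ} (hT : 1 ≤ T)
    (hg : ∀ t, 1 ≤ t → 0 < g t) (hg' : ∀ t, 1 ≤ t → g (t + 1) ≤ g t)
    (hV : ∀ t, 1 ≤ t → t ≤ T → V t ≤ A)
    (hVW : ∀ t, 1 ≤ t → t < T → V (t + 1) ≤ W t)
    (hstep : ∀ t, 1 ≤ t → t ≤ T → W t + g t * h t ≤ V t + g t * D t) :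
    ∑ t ∈ Finset.Icc 1 T, h t + W T / g T ≤ A / g T + ∑ t ∈ Finset.Icc 1 T, D t := by
  have hdiv : ∀ t, 1 ≤ t → t ≤ T → W t / g t + h t ≤ V t / g t + D t := by
    intro t h1 h2
    have h3 := div_le_div_of_nonneg_right (hstep t h1 h2) (hg t h1).le
    rwa [add_div, add_div, mul_div_cancel_left₀ _ (hg t h1).ne',
      mul_div_cancel_left₀ _ (hg t h1).ne'] at h3
  have key : ∀ k, 1 ≤ k → k ≤ T →
      ∑ t ∈ Finset.Icc 1 k, h t + W k / g k ≤ A / g k + ∑ t ∈ Finset.Icc 1 k, D t := by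
    intro k hk
    induction k, hk using Nat.le_induction with
    | base =>
      intro h1
      have h2 := hdiv 1 le_rfl h1
      have h3 := div_le_div_of_nonneg_right (hV 1 le_rfl h1) (hg 1 le_rfl).le
      simp only [Finset.Icc_self, Finset.sum_singleton]
      linarith
    | succ k hk ih =>
      intro h1
      have h2 := ih (by omega)
      have h3 := hdiv (k + 1) (by omega) h1
      have h4 := hVW k hk (by omega)
      have h5 := hV (k + 1) (by omega) h1
      have hg1 := hg k hk
      have hg2 := hg (k + 1) (by omega)
      have h6 : 1 / g k ≤ 1 / g (k + 1) := one_div_le_one_div_of_le hg2 (hg' k hk)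
      have h7 : V (k + 1) / g k ≤ W k / g k := div_le_div_of_nonneg_right h4 hg1.le
      -- Changing the weight from `1 / g k` to the larger `1 / g (k + 1)` costs at most `A` times
      -- the increase, because `V (k + 1) ≤ A`; these costs telescope.
      have h8 : 0 ≤ (A - V (k + 1)) * (1 / g (k + 1) - 1 / g k) :=
        mul_nonneg (by linarith) (by linarith)
      have h9 : (A - V (k + 1)) * (1 / g (k + 1) - 1 / g k) =
          A / g (k + 1) - A / g k - V (k + 1) / g (k + 1) + V (k + 1) / g k := by ring
      rw [Finset.sum_Icc_succ_top (by omega), Finset.sum_Icc_succ_top (by omega)]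
      linarith
  exact key T hT le_rfl

/-- Markov's inequality for the number of indices with a large value and for a random index. -/
theorem markov_average {Ω : Type*} [MeasurableSpace Ω] {P : Measure Ω} [IsProbabilityMeasure P]
    {T : ℕ} (hT : 1 ≤ T) {ε δ : ℝ} (hε : 0 < ε) (hδ : 0 < δ) {gap : ℕ → Ω → ℝ}
    (hmeas : ∀ t ∈ Finset.Icc 1 T, Measurable (gap t)) (h0 : ∀ t ω, 0 ≤ gap t ω)
    (hint : ∀ t ∈ Finset.Icc 1 T, Integrable (gap t) P)
    (hsum : ∑ t ∈ Finset.Icc 1 T, ∫ ω, gap t ω ∂P ≤ T * ε)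
    {Q : ℝ → ℕ → Ω → Prop}
    (hQ : ∀ η, ∀ t ∈ Finset.Icc 1 T, ∀ ω, gap t ω ≤ η → Q η t ω) :
    1 - δ ≤ P.real {ω | (1 - δ) * (T : ℝ) ≤
      (({t : ℕ | t ∈ Set.Icc 1 T ∧ Q (ε / δ ^ 2) t ω}.ncard : ℕ) : ℝ)} ∧
    1 - δ ≤ (P.prod (uniformOn (Set.Icc 1 T))).real {q : Ω × ℕ | Q (ε / δ) q.2 q.1} := by
  classical
  have hTpos : (0 : ℝ) < T := by exact_mod_cast hT
  constructor
  · set S : Ω → ℝ := fun ω => ∑ t ∈ Finset.Icc 1 T, gap t ω with hS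
    have hSmeas : Measurable S := Finset.measurable_sum _ hmeas
    have hSint : Integrable S P := integrable_finsetSum _ hint
    have hSE : ∫ ω, S ω ∂P ≤ T * ε := by rwa [integral_finsetSum _ hint]
    have hmk := mul_meas_ge_le_integral_of_nonneg
      (Filter.Eventually.of_forall fun ω => Finset.sum_nonneg fun t _ => h0 t ω) hSint (T * ε / δ)
    have hbad : P.real {ω | T * ε / δ ≤ S ω} ≤ δ := by
      have h1 : T * ε / δ * P.real {ω | T * ε / δ ≤ S ω} ≤ T * ε / δ * δ := by
        rw [div_mul_cancel₀ _ hδ.ne']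
        exact hmk.trans hSE
      exact le_of_mul_le_mul_left h1 (by positivity)
    have hset : MeasurableSet {ω | T * ε / δ ≤ S ω} := measurableSet_le measurable_const hSmeas
    have hcompl := probReal_compl_eq_one_sub (μ := P) hset
    -- `Q` is not assumed measurable, so the bound goes through the measurable event that the total
    -- gap is below `T * ε / δ`. On it at most `δ * T` gaps exceed `ε / δ ^ 2`: one factor `δ` is
    -- spent on the probability, the other on the count.
    refine le_trans (b := P.real {ω | T * ε / δ ≤ S ω}ᶜ) (by linarith)
      (measureReal_mono (fun ω hω => ?_))
    have hω' : S ω < T * ε / δ := not_le.1 hω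
    set η := ε / δ ^ 2 with hη
    have hηpos : 0 < η := by positivity
    set bad := (Finset.Icc 1 T).filter fun t => ¬ gap t ω ≤ η
    set good := (Finset.Icc 1 T).filter fun t => gap t ω ≤ η
    have hcard : good.card + bad.card = T := by
      rw [Finset.card_filter_add_card_filter_not]
      simp
    have h1 : bad.card * η ≤ S ω := by
      calc (bad.card : ℝ) * η = ∑ t ∈ bad, η := by simp
        _ ≤ ∑ t ∈ bad, gap t ω := Finset.sum_le_sum fun t ht =>
            (not_le.1 (Finset.mem_filter.1 ht).2).le
        _ ≤ S ω := Finset.sum_le_sum_of_subset_of_nonneg (Finset.filter_subset _ _)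
            fun t _ _ => h0 t ω
    have h2 : (bad.card : ℝ) ≤ δ * T := by
      have h3 : (bad.card : ℝ) * η ≤ δ * T * η := by
        have : δ * T * η = T * ε / δ := by
          rw [hη]; field_simp
        linarith
      exact le_of_mul_le_mul_right h3 hηpos
    have hle : good.card ≤ {t : ℕ | t ∈ Set.Icc 1 T ∧ Q η t ω}.ncard := by
      rw [← Set.ncard_coe_finset]
      refine Set.ncard_le_ncard (fun t ht => ?_) ((Set.finite_Icc 1 T).subset fun t ht => ht.1)
      have ht' := Finset.mem_filter.1 (Finset.mem_coe.1 ht)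
      exact ⟨Finset.mem_Icc.1 ht'.1, hQ η t ht'.1 ω ht'.2⟩
    have hle' : (good.card : ℝ) ≤ ({t : ℕ | t ∈ Set.Icc 1 T ∧ Q η t ω}.ncard : ℕ) := by
      exact_mod_cast hle
    have hcard' : (good.card : ℝ) + bad.card = T := by exact_mod_cast hcard
    change (1 - δ) * (T : ℝ) ≤ _
    linarith
  · have : IsProbabilityMeasure (uniformOn (Set.Icc 1 T)) :=
      isProbabilityMeasure_uniformOn (Set.finite_Icc 1 T) ⟨1, by simpa using hT⟩
    set η := ε / δ with hη
    have hηpos : 0 < η := by positivity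
    -- Disjoint measurable rectangles inside the target set; Markov's inequality in each round
    -- already gives them total mass at least `1 - δ`.
    set U : ℕ → Set (Ω × ℕ) := fun t => {ω | gap t ω < η} ×ˢ {t} with hU
    have hAmeas : ∀ t ∈ Finset.Icc 1 T, MeasurableSet {ω | gap t ω < η} := fun t ht =>
      measurableSet_lt (hmeas t ht) measurable_const
    have hsub : (⋃ t ∈ Finset.Icc 1 T, U t) ⊆ {q : Ω × ℕ | Q η q.2 q.1} := by
      rintro ⟨ω, s⟩ hq
      simp only [Set.mem_iUnion] at hq
      obtain ⟨t, ht, h1, h2⟩ := hq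
      have h2' : s = t := h2
      subst h2'
      exact hQ η s ht ω (le_of_lt h1)
    refine le_trans ?_ (measureReal_mono hsub)
    rw [measureReal_biUnion_finset]
    · have hunif : ∀ t ∈ Finset.Icc 1 T, (uniformOn (Set.Icc 1 T)).real {t} = 1 / T := by
        intro t ht
        have h1 := uniformOn_apply_finset (s := Finset.Icc 1 T) (t := {t})
        have h2 : Finset.Icc 1 T ∩ {t} = {t} := by simpa using ht
        rw [h2] at h1
        simp only [Finset.coe_Icc, Finset.coe_singleton, Finset.card_singleton,
          Nat.card_Icc, Nat.add_sub_cancel, Nat.cast_one] at h1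
        rw [measureReal_def, h1]
        simp
      have hA : ∀ t ∈ Finset.Icc 1 T, 1 - (∫ ω, gap t ω ∂P) / η ≤ P.real {ω | gap t ω < η} := by
        intro t ht
        have h1 := mul_meas_ge_le_integral_of_nonneg
          (Filter.Eventually.of_forall fun ω => h0 t ω) (hint t ht) η
        have h2 := probReal_compl_eq_one_sub (μ := P) (hAmeas t ht)
        have h3 : {ω | gap t ω < η}ᶜ = {ω | η ≤ gap t ω} := by
          ext ω; simp
        rw [h3] at h2
        have h4 : P.real {ω | η ≤ gap t ω} ≤ (∫ ω, gap t ω ∂P) / η := by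
          rw [le_div_iff₀ hηpos, mul_comm]; exact h1
        linarith
      calc 1 - δ ≤ ∑ t ∈ Finset.Icc 1 T, (1 - (∫ ω, gap t ω ∂P) / η) * (1 / T) := by
            rw [← Finset.sum_mul, Finset.sum_sub_distrib, ← Finset.sum_div]
            simp only [Finset.sum_const, Nat.card_Icc, Nat.add_sub_cancel, nsmul_eq_mul, mul_one]
            have h1 : (∑ t ∈ Finset.Icc 1 T, ∫ ω, gap t ω ∂P) / η ≤ T * δ := by
              rw [div_le_iff₀ hηpos, hη]
              have : T * δ * (ε / δ) = T * ε := by field_simp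
              rw [this]
              exact hsum
            have h2 : (T - T * δ) * (1 / (T : ℝ)) = 1 - δ := by field_simp
            rw [← h2]
            gcongr
        _ ≤ ∑ t ∈ Finset.Icc 1 T, (P.prod (uniformOn (Set.Icc 1 T))).real (U t) := by
            refine Finset.sum_le_sum fun t ht => ?_
            rw [hU, measureReal_prod_prod, hunif t ht]
            gcongr
            exact hA t ht
    · intro s _ t _ hst
      refine Set.disjoint_left.2 ?_
      rintro ⟨ω, r⟩ ⟨_, h1⟩ ⟨_, h2⟩
      exact hst (Eq.trans (Eq.symm h1) h2)
    · intro t ht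
      exact (hAmeas t ht).prod (measurableSet_singleton t)

/-! ### Summing the descent along a run -/

namespace CongestionGame

variable {n m : ℕ} {G : CongestionGame n m}

theorem measurable_nashGap : Measurable G.nashGap := by
  refine Measurable.iSup fun k => measurable_const.max ?_
  refine Continuous.measurable ?_
  have := fun e => G.continuous_marginal k.1 e
  unfold deviationGain
  fun_prop

theorem nashGap_le_of_inCube {x : Fin n → EuclideanSpace ℝ (Fin m)} (hx : InCube x) :
    G.nashGap x ≤ m * G.cMax := by
  have hc := G.cMax_nonneg
  refine nashGap_le (by positivity) fun i s hs => ?_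
  have : ∀ e ∈ Finset.univ, G.marginal x i e * (x i e - incidence s e) ≤ G.cMax := by
    intro e _
    have h1 := marginal_mem (G := G) hx i e
    have h2 := hx i e
    have h3 : 0 ≤ incidence s e := by rw [incidence_apply]; split_ifs <;> norm_num
    calc _ ≤ G.marginal x i e * 1 := mul_le_mul_of_nonneg_left (by linarith [h2.2]) h1.1
      _ ≤ _ := by rw [mul_one]; exact h1.2
  unfold deviationGain
  simpa using Finset.sum_le_card_nsmul _ _ _ this

theorem measurable_costEstimate (i : Fin n) (a : G.Profile) :
    Measurable (G.costEstimate i a) := by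
  refine (WithLp.measurable_toLp 2 _).comp (measurable_pi_lambda _ fun e => ?_)
  split_ifs
  · exact measurable_const.div (Continuous.measurable (by fun_prop))
  · exact measurable_const

theorem measurable_envelope_step (μ : Fin n → ℝ) (γ : ℝ) (a : G.Profile) :
    Measurable fun x : Fin n → EuclideanSpace ℝ (Fin m) =>
      G.envelope μ fun i => x i - γ • G.costEstimate i a (x i) := by
  refine (continuous_envelope μ).measurable.comp (measurable_pi_lambda _ fun i => ?_)
  have h1 := (measurable_costEstimate i a).comp (measurable_pi_apply (X := fun _ : Fin n =>
    EuclideanSpace ℝ (Fin m)) i)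
  exact (measurable_pi_apply i).sub (h1.const_smul γ)

section Run

variable {γ : ℕ → ℝ} {μ : Fin n → ℕ → ℝ} {σ : ℕ → ℝ} {T : ℕ} {Ω : Type*} [mΩ : MeasurableSpace Ω]
  {P : Measure Ω} {ℱ : Filtration ℕ mΩ} {x : ℕ → Ω → Fin n → EuclideanSpace ℝ (Fin m)}
  {π : ℕ → Ω → G.MixedProfile} {p : ℕ → Ω → G.Profile}

theorem IsRun.mem_domain (h : G.IsRun γ μ T P ℱ x π p) {t : ℕ} (h1 : 1 ≤ t) (hT : t ≤ T) (ω : Ω) :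
    x t ω ∈ G.domain fun i => μ i t := by
  intro i _
  rcases h1.eq_or_lt with rfl | h2
  · exact h.init ω i
  · obtain ⟨s, rfl⟩ := Nat.exists_eq_add_of_le' h1
    exact (h.update s (by omega) (by omega) ω i).1

theorem IsRun.represents (h : G.IsRun γ μ T P ℱ x π p) {t : ℕ} (h1 : 1 ≤ t) (hT : t ≤ T) (ω : Ω) :
    G.Represents (π t ω) (x t ω) := by
  intro i
  obtain ⟨h2, _, h3⟩ := h.decompose t h1 hT ω i
  exact ⟨h2, by ext e; exact h3 e⟩

theorem inv_le_of_mem_domain {μ : Fin n → ℝ} {σ : ℝ} (hσ : 0 < σ)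
    (hμ : ∀ i, μ i = min (1 / ((G.active i).card : ℝ)) σ)
    {x : Fin n → EuclideanSpace ℝ (Fin m)} (hx : x ∈ G.domain μ) (i : Fin n) (e : Fin m)
    (he : e ∈ G.active i) : 0 < x i e ∧ (x i e)⁻¹ ≤ m + 1 / σ := by
  have h1 := (hx i trivial).2 e he
  rw [hμ] at h1
  have hk : 0 < (G.active i).card := Finset.card_pos.2 ⟨e, he⟩
  have hk' : (0 : ℝ) < (G.active i).card := by exact_mod_cast hk
  have hkm : ((G.active i).card : ℝ) ≤ m := by
    have := Finset.card_le_univ (G.active i)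
    rw [Fintype.card_fin] at this
    exact_mod_cast this
  have hpos : 0 < x i e := lt_of_lt_of_le (lt_min (by positivity) hσ) h1
  refine ⟨hpos, ?_⟩
  rcases min_le_iff.1 h1 with h2 | h2
  · have h3 : (x i e)⁻¹ ≤ (G.active i).card := by
      rw [inv_le_comm₀ hpos hk']; simpa using h2
    have : 0 < 1 / σ := by positivity
    linarith
  · have h3 : (x i e)⁻¹ ≤ 1 / σ := by
      rw [one_div]; exact inv_anti₀ hσ h2
    have : (0 : ℝ) ≤ m := by positivity
    linarith

/-- A deterministic bound on the step length, which keeps the envelope after an unprojected step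
bounded and hence integrable. -/
theorem sqDist_step_le {μ : Fin n → ℝ} {σ : ℝ} (hσ : 0 < σ)
    (hμ : ∀ i, μ i = min (1 / ((G.active i).card : ℝ)) σ)
    {x : Fin n → EuclideanSpace ℝ (Fin m)} (hx : x ∈ G.domain μ) (γ : ℝ) (a : G.Profile) :
    sqDist (fun i => x i - γ • G.costEstimate i a (x i)) x ≤
      n * m * (γ ^ 2 * (G.cMax ^ 2 * (m + 1 / σ) ^ 2)) := by
  have h : ∀ i e, ((x i - γ • G.costEstimate i a (x i)) e - x i e) ^ 2 ≤
      γ ^ 2 * (G.cMax ^ 2 * (m + 1 / σ) ^ 2) := by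
    intro i e
    have h1 := (costEstimate_sq_le i a (fun e he => inv_le_of_mem_domain hσ hμ hx i e he) e).2
    simp only [PiLp.sub_apply, PiLp.smul_apply, smul_eq_mul]
    calc _ = γ ^ 2 * G.costEstimate i a (x i) e ^ 2 := by ring
      _ ≤ _ := by gcongr
  refine (Finset.sum_le_sum fun i _ => Finset.sum_le_sum fun e _ => h i e).trans (le_of_eq ?_)
  simp
  ring

/-- `integral_sampled` identifies the expected envelope after a step with the integral of the
product expectation in `envelope_decrease`. On the iterates the envelope lies between `0` and `n * m
* cMax`, which is the total budget in `sum_le_of_descent`; growing domains and projection provide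
the passage to the next round. -/
theorem IsRun.sum_integral_gap_sq_le [IsProbabilityMeasure P] (h : G.IsRun γ μ T P ℱ x π p)
    (hm : 0 < m) (hT : 1 ≤ T)
    (hγ : ∀ t, 1 ≤ t → 0 < γ t) (hγ' : ∀ t, 1 ≤ t → γ (t + 1) ≤ γ t)
    (hσ : ∀ t, 1 ≤ t → 0 < σ t) (hσ' : ∀ t, 1 ≤ t → σ (t + 1) ≤ σ t)
    (hμ : ∀ i t, μ i t = min (1 / ((G.active i).card : ℝ)) (σ t)) :
    ∑ t ∈ Finset.Icc 1 T, ∫ ω, max 0 (G.nashGap (x t ω) - m ^ 2 * G.cMax * σ t) ^ 2 ∂P ≤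
      9 * m * (n * m * G.cMax / γ T +
        2 * n ^ 2 * m * G.cMax ^ 3 * ∑ t ∈ Finset.Icc 1 T, γ t * (m + 1 / σ t)) := by
  have hc := G.cMax_nonneg
  have hm' : (0 : ℝ) < m := by exact_mod_cast hm
  set V : ℕ → ℝ := fun t => ∫ ω, G.envelope (fun i => μ i t) (x t ω) ∂P with hV
  set Y : ℕ → G.Profile → Ω → ℝ := fun t a ω => G.envelope (fun i => μ i t)
    (fun i => x t ω i - γ t • G.costEstimate i a (x t ω i)) with hY
  set W : ℕ → ℝ := fun t => ∫ ω, Y t (p t ω) ω ∂P with hW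
  set H : ℕ → ℝ := fun t =>
    ∫ ω, max 0 (G.nashGap (x t ω) - m ^ 2 * G.cMax * σ t) ^ 2 ∂P with hH
  have hxm : ∀ t, 1 ≤ t → t ≤ T → Measurable (x t) := fun t h1 h2 =>
    (h.measurable_point t h1 h2).mono (ℱ.le t) le_rfl
  have hne : ∀ t, 1 ≤ t → t ≤ T → ∀ ω : Ω, (G.domain fun i => μ i t).Nonempty :=
    fun t h1 h2 ω => ⟨_, h.mem_domain h1 h2 ω⟩
  have hVbd : ∀ t, 1 ≤ t → t ≤ T → ∀ ω, G.envelope (fun i => μ i t) (x t ω) ∈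
      Set.Icc 0 (n * m * G.cMax) := fun t h1 h2 ω =>
    ⟨envelope_nonneg (hne t h1 h2 ω) _, (envelope_le_potential (h.mem_domain h1 h2 ω)).trans
      (potential_mem (inCube_of_mem_domain (h.mem_domain h1 h2 ω))).2⟩
  have hVint : ∀ t, 1 ≤ t → t ≤ T →
      Integrable (fun ω => G.envelope (fun i => μ i t) (x t ω)) P := by
    intro t h1 h2
    refine Integrable.of_bound ((continuous_envelope _).measurable.comp
      (hxm t h1 h2)).aestronglyMeasurable (n * m * G.cMax) (Filter.Eventually.of_forall fun ω => ?_)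
    rw [Real.norm_eq_abs, abs_of_nonneg (hVbd t h1 h2 ω).1]
    exact (hVbd t h1 h2 ω).2
  have hVA : ∀ t, 1 ≤ t → t ≤ T → V t ≤ n * m * G.cMax := by
    intro t h1 h2
    have := integral_mono (hVint t h1 h2) (integrable_const _) fun ω => (hVbd t h1 h2 ω).2
    simpa using this
  have hYbd : ∀ t, 1 ≤ t → t ≤ T → ∀ a ω, |Y t a ω| ≤ n * m * G.cMax + 2 * n * G.cMax *
      (n * m * (γ t ^ 2 * (G.cMax ^ 2 * (m + 1 / σ t) ^ 2))) := by
    intro t h1 h2 a ω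
    have hx := h.mem_domain h1 h2 ω
    rw [abs_of_nonneg (envelope_nonneg ⟨_, hx⟩ _)]
    refine (envelope_le hx _).trans ?_
    gcongr
    · exact (potential_mem (inCube_of_mem_domain hx)).2
    · exact sqDist_step_le (hσ t h1) (fun i => hμ i t) hx (γ t) a
  have hYmeas : ∀ t, 1 ≤ t → t ≤ T → ∀ a, Measurable[ℱ t] (Y t a) := fun t h1 h2 a =>
    (measurable_envelope_step (fun i => μ i t) (γ t) a).comp (h.measurable_point t h1 h2)
  have hsamp := fun t (h1 : 1 ≤ t) (h2 : t ≤ T) => integral_sampled (ℱ.le t)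
    (fun a => ℱ.le (t + 1) _ (h.measurable_pure t h1 h2 a)) (h.sample t h1 h2)
    (hYmeas t h1 h2) (hYbd t h1 h2)
  have hW0 : ∀ t, 1 ≤ t → t ≤ T → 0 ≤ W t := fun t h1 h2 =>
    integral_nonneg fun ω => envelope_nonneg (hne t h1 h2 ω) _
  have hVW : ∀ t, 1 ≤ t → t < T → V (t + 1) ≤ W t := by
    intro t h1 h2
    refine integral_mono (hVint (t + 1) (by omega) h2) (hsamp t h1 h2.le).1 fun ω => ?_
    refine envelope_projection_le (fun i => ?_) (hne t h1 h2.le ω) fun i => h.update t h1 h2 ω i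
    rw [hμ, hμ]
    exact min_le_min le_rfl (hσ' t h1)
  have hHint : ∀ t, 1 ≤ t → t ≤ T → Integrable
      (fun ω => max 0 (G.nashGap (x t ω) - m ^ 2 * G.cMax * σ t) ^ 2) P := by
    intro t h1 h2
    refine Integrable.of_bound (Measurable.aestronglyMeasurable ?_) ((m * G.cMax) ^ 2)
      (Filter.Eventually.of_forall fun ω => ?_)
    · exact (measurable_const.max
        ((measurable_nashGap.comp (hxm t h1 h2)).sub_const _)).pow_const 2
    · rw [Real.norm_eq_abs, abs_of_nonneg (sq_nonneg _)]
      have h3 := nashGap_le_of_inCube (G := G) (inCube_of_mem_domain (h.mem_domain h1 h2 ω))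
      have h4 : 0 ≤ m ^ 2 * G.cMax * σ t := by
        have := hσ t h1
        positivity
      exact pow_le_pow_left₀ (le_max_left _ _) (max_le (by positivity) (by linarith)) 2
  have hstep : ∀ t, 1 ≤ t → t ≤ T → W t + γ t * (H t / (9 * m)) ≤
      V t + γ t * (2 * n ^ 2 * m * G.cMax ^ 3 * (γ t * (m + 1 / σ t))) := by
    intro t h1 h2
    obtain ⟨_, hi2, hi3⟩ := hsamp t h1 h2
    have hpt : ∀ ω, (∑ a, (∏ i, π t ω i (a i)) * Y t a ω) + γ t / (9 * m) *
        max 0 (G.nashGap (x t ω) - m ^ 2 * G.cMax * σ t) ^ 2 ≤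
        G.envelope (fun i => μ i t) (x t ω) +
          2 * n ^ 2 * m * G.cMax ^ 3 * γ t ^ 2 * (m + 1 / σ t) := by
      intro ω
      have hs := hσ t h1
      exact envelope_decrease hm (h.represents h1 h2 ω) hs.le (fun i => hμ i t)
        (h.mem_domain h1 h2 ω) (by positivity)
        (fun i e he => inv_le_of_mem_domain hs (fun i => hμ i t) (h.mem_domain h1 h2 ω) i e he)
        (hγ t h1).le
    have h3 := integral_mono (hi2.add ((hHint t h1 h2).const_mul (γ t / (9 * m))))
      ((hVint t h1 h2).add (integrable_const
        (2 * n ^ 2 * m * G.cMax ^ 3 * γ t ^ 2 * (m + 1 / σ t)))) hpt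
    simp only [Pi.add_apply] at h3
    rw [integral_add hi2 ((hHint t h1 h2).const_mul _),
      integral_add (hVint t h1 h2) (integrable_const _), integral_const_mul, ← hi3] at h3
    simp only [integral_const, probReal_univ, smul_eq_mul, one_mul] at h3
    change W t + γ t / (9 * m) * H t ≤ V t + _ at h3
    calc W t + γ t * (H t / (9 * m)) = W t + γ t / (9 * m) * H t := by ring
      _ ≤ _ := h3
      _ = _ := by ring
  have hfin := sum_le_of_descent hT hγ hγ' hVA hVW hstep
  have hWT : 0 ≤ W T / γ T := div_nonneg (hW0 T hT le_rfl) (hγ T hT).le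
  rw [← Finset.sum_div, ← Finset.mul_sum] at hfin
  have h4 : (∑ t ∈ Finset.Icc 1 T, H t) / (9 * m) ≤ n * m * G.cMax / γ T +
      2 * n ^ 2 * m * G.cMax ^ 3 * ∑ t ∈ Finset.Icc 1 T, γ t * (m + 1 / σ t) := by linarith
  rw [div_le_iff₀ (by positivity)] at h4
  linarith

/-- Here `θ` is the root-mean-square level allowed for the excess of the gap over the exploration
bias. The bias and `θ` together must fit into the target average `ε`. -/
theorem IsRun.conclusion [IsProbabilityMeasure P] (h : G.IsRun γ μ T P ℱ x π p)
    (hm : 0 < m) (hT : 1 ≤ T)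
    (hγ : ∀ t, 1 ≤ t → 0 < γ t) (hγ' : ∀ t, 1 ≤ t → γ (t + 1) ≤ γ t)
    (hσ : ∀ t, 1 ≤ t → 0 < σ t) (hσ' : ∀ t, 1 ≤ t → σ (t + 1) ≤ σ t)
    (hμ : ∀ i t, μ i t = min (1 / ((G.active i).card : ℝ)) (σ t))
    {θ ε δ : ℝ} (hθ : 0 < θ) (hε : 0 < ε) (hδ : 0 < δ)
    (hvar : 9 * m * (n * m * G.cMax / γ T +
        2 * n ^ 2 * m * G.cMax ^ 3 * ∑ t ∈ Finset.Icc 1 T, γ t * (m + 1 / σ t)) ≤ T * θ ^ 2)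
    (hbias : m ^ 2 * G.cMax * ∑ t ∈ Finset.Icc 1 T, σ t + T * θ ≤ T * ε) :
    1 - δ ≤ P.real {ω | (1 - δ) * (T : ℝ) ≤
      (({t : ℕ | t ∈ Set.Icc 1 T ∧ G.IsApproxMixedNE (ε / δ ^ 2) (π t ω)}.ncard : ℕ) : ℝ)} ∧
    1 - δ ≤ (P.prod (uniformOn (Set.Icc 1 T))).real
      {q : Ω × ℕ | G.IsApproxMixedNE (ε / δ) (π q.2 q.1)} := by
  have hc := G.cMax_nonneg
  have hsq := (h.sum_integral_gap_sq_le hm hT hγ hγ' hσ hσ' hμ).trans hvar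
  have hxm : ∀ t ∈ Finset.Icc 1 T, Measurable (x t) := fun t ht =>
    (h.measurable_point t (Finset.mem_Icc.1 ht).1 (Finset.mem_Icc.1 ht).2).mono (ℱ.le t) le_rfl
  have hcube : ∀ t ∈ Finset.Icc 1 T, ∀ ω, InCube (x t ω) := fun t ht ω =>
    inCube_of_mem_domain (h.mem_domain (Finset.mem_Icc.1 ht).1 (Finset.mem_Icc.1 ht).2 ω)
  have hgm : ∀ t ∈ Finset.Icc 1 T, Measurable fun ω => G.nashGap (x t ω) := fun t ht =>
    measurable_nashGap.comp (hxm t ht)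
  have hgi : ∀ t ∈ Finset.Icc 1 T, Integrable (fun ω => G.nashGap (x t ω)) P := by
    intro t ht
    refine Integrable.of_bound (hgm t ht).aestronglyMeasurable (m * G.cMax)
      (Filter.Eventually.of_forall fun ω => ?_)
    rw [Real.norm_eq_abs, abs_of_nonneg nashGap_nonneg]
    exact nashGap_le_of_inCube (G := G) (hcube t ht ω)
  have hterm : ∀ t ∈ Finset.Icc 1 T, ∫ ω, G.nashGap (x t ω) ∂P ≤ m ^ 2 * G.cMax * σ t + θ / 2 +
      1 / (2 * θ) * ∫ ω, max 0 (G.nashGap (x t ω) - m ^ 2 * G.cMax * σ t) ^ 2 ∂P := by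
    intro t ht
    have hs := hσ t (Finset.mem_Icc.1 ht).1
    have hHi : Integrable
        (fun ω => max 0 (G.nashGap (x t ω) - m ^ 2 * G.cMax * σ t) ^ 2) P := by
      refine Integrable.of_bound (Measurable.aestronglyMeasurable ?_) ((m * G.cMax) ^ 2)
        (Filter.Eventually.of_forall fun ω => ?_)
      · exact (measurable_const.max ((hgm t ht).sub_const _)).pow_const 2
      · rw [Real.norm_eq_abs, abs_of_nonneg (sq_nonneg _)]
        have h3 := nashGap_le_of_inCube (G := G) (hcube t ht ω)
        have h4 : 0 ≤ m ^ 2 * G.cMax * σ t := by positivity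
        exact pow_le_pow_left₀ (le_max_left _ _) (max_le (by positivity) (by linarith)) 2
    have h3 := integral_mono (hgi t ht) ((integrable_const (m ^ 2 * G.cMax * σ t + θ / 2)).add
      (hHi.const_mul (1 / (2 * θ)))) (fun ω => by
        simp only [Pi.add_apply]
        set r := max 0 (G.nashGap (x t ω) - m ^ 2 * G.cMax * σ t) with hr
        have h5 : G.nashGap (x t ω) - m ^ 2 * G.cMax * σ t ≤ r := le_max_right _ _
        -- The arithmetic–geometric mean inequality passes from the second moment to the first.
        -- After summation each of the two terms contributes `T * θ / 2`.
        have h6 : r ≤ θ / 2 + 1 / (2 * θ) * r ^ 2 := by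
          have h7 : θ / 2 + 1 / (2 * θ) * r ^ 2 - r = (θ - r) ^ 2 / (2 * θ) := by
            field_simp
            ring
          have h8 : 0 ≤ (θ - r) ^ 2 / (2 * θ) := by positivity
          linarith
        linarith)
    simp only [Pi.add_apply] at h3
    rw [integral_add (integrable_const _) (hHi.const_mul _), integral_const_mul] at h3
    simpa using h3
  have hsum : ∑ t ∈ Finset.Icc 1 T, ∫ ω, G.nashGap (x t ω) ∂P ≤ T * ε := by
    refine (Finset.sum_le_sum hterm).trans (le_trans ?_ hbias)
    rw [Finset.sum_add_distrib, Finset.sum_add_distrib, ← Finset.mul_sum, ← Finset.mul_sum]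
    simp only [Finset.sum_const, Nat.card_Icc, Nat.add_sub_cancel, nsmul_eq_mul]
    have h3 := mul_le_mul_of_nonneg_left hsq (by positivity : 0 ≤ 1 / (2 * θ))
    have h4 : 1 / (2 * θ) * (T * θ ^ 2) = T * (θ / 2) := by
      field_simp
    linarith
  exact markov_average hT hε hδ (gap := fun t ω => G.nashGap (x t ω)) hgm
    (fun _ _ => nashGap_nonneg) hgi hsum (Q := fun η t ω => G.IsApproxMixedNE η (π t ω))
    fun η t ht ω hle => isApproxMixedNE_of_nashGap_le
      (h.represents (Finset.mem_Icc.1 ht).1 (Finset.mem_Icc.1 ht).2 ω) hle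

end Run

end CongestionGame

/-! ### Power sums and polynomial rates -/

/-- Induction on `T`: Bernoulli's inequality with exponent `1 - q ≤ 1` bounds the new summand by the
increment of the right-hand side. -/
theorem sum_Icc_rpow_neg_le {q : ℝ} (hq0 : 0 ≤ q) (hq1 : q < 1) (T : ℕ) :
    ∑ t ∈ Finset.Icc 1 T, (t : ℝ) ^ (-q) ≤ (T : ℝ) ^ (1 - q) / (1 - q) := by
  have hr : 0 < 1 - q := by linarith
  induction T with
  | zero => simp [Real.zero_rpow hr.ne']
  | succ k ih =>
    rw [Finset.sum_Icc_succ_top (by omega)]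
    have hk : (0 : ℝ) < ((k + 1 : ℕ) : ℝ) := by positivity
    set t : ℝ := ((k + 1 : ℕ) : ℝ) with ht
    have hkt : (k : ℝ) = t * (1 + -(1 / t)) := by
      rw [mul_add, mul_neg, mul_one_div_cancel hk.ne', ht]; push_cast; ring
    have h1t : 1 / t ≤ 1 := by
      rw [div_le_one hk, ht]; push_cast; linarith [(Nat.cast_nonneg k : (0 : ℝ) ≤ k)]
    have hb := rpow_one_add_le_one_add_mul_self (s := -(1 / t)) (by linarith) hr.le (by linarith)
    have h2 : (k : ℝ) ^ (1 - q) ≤ t ^ (1 - q) - (1 - q) * t ^ (-q) := by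
      rw [hkt, Real.mul_rpow hk.le (by linarith)]
      have h3 : t ^ (1 - q) = t * t ^ (-q) := by
        rw [sub_eq_add_neg, Real.rpow_add hk, Real.rpow_one]
      calc _ ≤ t ^ (1 - q) * (1 + (1 - q) * -(1 / t)) := by gcongr
        _ = _ := by rw [h3]; field_simp; ring
    have h4 : (k : ℝ) ^ (1 - q) / (1 - q) ≤ t ^ (1 - q) / (1 - q) - t ^ (-q) := by
      rw [div_le_iff₀ hr, sub_mul, div_mul_cancel₀ _ hr.ne']
      linarith
    linarith

theorem rpow_neg_succ_le {q : ℝ} (hq : 0 ≤ q) {t : ℕ} (ht : 1 ≤ t) :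
    ((t + 1 : ℕ) : ℝ) ^ (-q) ≤ (t : ℝ) ^ (-q) :=
  Real.rpow_le_rpow_of_nonpos (by exact_mod_cast ht) (by push_cast; linarith) (by linarith)

/-- A fractional power as an integral power of the root `z ^ (1 / k)`. -/
theorem rpow_eq_pow_root {z : ℝ} (hz : 0 ≤ z) (k : ℝ) (l : ℕ) {q : ℝ} (hq : q = l / k) :
    z ^ q = (z ^ (1 / k)) ^ l := by
  rw [← Real.rpow_natCast, ← Real.rpow_mul hz, hq]
  ring_nf

theorem rpow_neg_eq_pow_root {z : ℝ} (hz : 0 ≤ z) (k : ℝ) (l : ℕ) {q : ℝ} (hq : q = l / k) :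
    z ^ (-q) = ((z ^ (1 / k)) ^ l)⁻¹ := by
  rw [Real.rpow_neg hz, rpow_eq_pow_root hz k l hq]

namespace CongestionGame

variable {n m : ℕ} {G : CongestionGame n m}

/-- With `τ = T^(1/5)`, the initial-potential term and the noise term both scale as `τ ^ 3` and the
summed bias as `τ ^ 4`. All dependence on `T` then collapses into one factor `τ`. The constant `10 /
3` is `2` times the factor `5 / 3` from summing `t^(-2/5)`. -/
theorem IsRun.conclusion_of_rates {γ : ℕ → ℝ} {μ : Fin n → ℕ → ℝ} {T : ℕ} {Ω : Type*}
    [mΩ : MeasurableSpace Ω] {P : Measure Ω} [IsProbabilityMeasure P] {ℱ : Filtration ℕ mΩ}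
    {x : ℕ → Ω → Fin n → EuclideanSpace ℝ (Fin m)} {π : ℕ → Ω → G.MixedProfile}
    {p : ℕ → Ω → G.Profile} (h : G.IsRun γ μ T P ℱ x π p) (hm : 0 < m) (hT : 1 ≤ T)
    {g s κ ε δ : ℝ} (hg : 0 < g) (hs : 0 < s) (hκ : 0 < κ) (hε : 0 < ε) (hδ : 0 < δ)
    (hγ : ∀ t, γ t = g * (t : ℝ) ^ (-(3 / 5) : ℝ))
    (hμ : ∀ i t, μ i t =
      min (1 / ((G.active i).card : ℝ)) (s * (t : ℝ) ^ (-(1 / 5) : ℝ)))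
    (hvar : 9 * m * (n * m * G.cMax / g + 10 / 3 * n ^ 2 * m * G.cMax ^ 3 * g * (m + 1 / s)) ≤
      κ ^ 2)
    (hbias : 5 / 4 * m ^ 2 * G.cMax * s + κ ≤ (T : ℝ) ^ (1 / 5 : ℝ) * ε) :
    1 - δ ≤ P.real {ω | (1 - δ) * (T : ℝ) ≤
      (({t : ℕ | t ∈ Set.Icc 1 T ∧ G.IsApproxMixedNE (ε / δ ^ 2) (π t ω)}.ncard : ℕ) : ℝ)} ∧
    1 - δ ≤ (P.prod (uniformOn (Set.Icc 1 T))).real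
      {q : Ω × ℕ | G.IsApproxMixedNE (ε / δ) (π q.2 q.1)} := by
  have hc := G.cMax_nonneg
  have hTpos : (0 : ℝ) < T := by exact_mod_cast hT
  set τ : ℝ := (T : ℝ) ^ (1 / 5 : ℝ) with hτ
  have hτpos : 0 < τ := Real.rpow_pos_of_pos hTpos _
  have hT5 : (T : ℝ) = τ ^ 5 := by
    rw [hτ, ← rpow_eq_pow_root hTpos.le 5 5 (q := 1) (by norm_num), Real.rpow_one]
  have hpow : ∀ (q : ℝ) (t : ℕ), 1 ≤ t → 0 < (t : ℝ) ^ q := fun q t ht =>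
    Real.rpow_pos_of_pos (by exact_mod_cast ht) _
  have hγT : γ T = g / τ ^ 3 := by
    rw [hγ, rpow_neg_eq_pow_root hTpos.le 5 3 (by norm_num)]
    exact (div_eq_mul_inv _ _).symm
  have hsum : ∑ t ∈ Finset.Icc 1 T, γ t * (m + 1 / (s * (t : ℝ) ^ (-(1 / 5) : ℝ))) ≤
      g * (m + 1 / s) * (5 / 3 * τ ^ 3) := by
    have h1 : ∀ t ∈ Finset.Icc 1 T, γ t * (m + 1 / (s * (t : ℝ) ^ (-(1 / 5) : ℝ))) ≤
        g * (m + 1 / s) * (t : ℝ) ^ (-(2 / 5) : ℝ) := by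
      intro t ht
      have ht1 : (1 : ℝ) ≤ t := by exact_mod_cast (Finset.mem_Icc.1 ht).1
      have ht0 : (0 : ℝ) ≤ t := by linarith
      rw [hγ, rpow_neg_eq_pow_root ht0 5 3 (by norm_num),
        rpow_neg_eq_pow_root ht0 5 1 (by norm_num),
        rpow_neg_eq_pow_root ht0 5 2 (by norm_num)]
      have hu : (1 : ℝ) ≤ (t : ℝ) ^ (1 / 5 : ℝ) := Real.one_le_rpow ht1 (by norm_num)
      set u := (t : ℝ) ^ (1 / 5 : ℝ)
      have hu0 : 0 < u := by linarith
      -- Since `u ≥ 1`, the summand `m` can be given the growth of the exploration term, so the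
      -- noise has the single exponent `-3/5 + 1/5 = -2/5`.
      have h2 : (m : ℝ) + 1 / (s * (u ^ 1)⁻¹) ≤ (m + 1 / s) * u := by
        have h3 : 1 / (s * (u ^ 1)⁻¹) = 1 / s * u := by field_simp
        rw [h3, add_mul]
        have : (m : ℝ) ≤ m * u := le_mul_of_one_le_right (by positivity) hu
        linarith
      calc g * (u ^ 3)⁻¹ * (m + 1 / (s * (u ^ 1)⁻¹)) ≤ g * (u ^ 3)⁻¹ * ((m + 1 / s) * u) := by
            gcongr
        _ = _ := by field_simp
    refine (Finset.sum_le_sum h1).trans ?_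
    rw [← Finset.mul_sum]
    have h2 := sum_Icc_rpow_neg_le (q := 2 / 5) (by norm_num) (by norm_num) T
    rw [rpow_eq_pow_root hTpos.le 5 3 (by norm_num)] at h2
    have h3 : 5 / 3 * τ ^ 3 = τ ^ 3 / (1 - 2 / 5) := by ring
    rw [h3]
    gcongr
  have hsumσ : ∑ t ∈ Finset.Icc 1 T, s * (t : ℝ) ^ (-(1 / 5) : ℝ) ≤ s * (5 / 4 * τ ^ 4) := by
    rw [← Finset.mul_sum]
    have h2 := sum_Icc_rpow_neg_le (q := 1 / 5) (by norm_num) (by norm_num) T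
    rw [rpow_eq_pow_root hTpos.le 5 4 (by norm_num)] at h2
    have h3 : 5 / 4 * τ ^ 4 = τ ^ 4 / (1 - 1 / 5) := by ring
    rw [h3]
    gcongr
  -- With `θ = κ / τ` and `T = τ ^ 5`, one has `T * θ ^ 2 = κ ^ 2 * τ ^ 3` and `T * θ = κ * τ ^ 4`,
  -- matching the two scalings.
  refine h.conclusion hm hT (σ := fun t => s * (t : ℝ) ^ (-(1 / 5) : ℝ)) (θ := κ / τ)
    ?_ ?_ ?_ ?_ hμ (by positivity) hε hδ ?_ ?_
  · intro t ht
    rw [hγ]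
    exact mul_pos hg (hpow _ t ht)
  · intro t ht
    rw [hγ, hγ]
    exact mul_le_mul_of_nonneg_left (rpow_neg_succ_le (by norm_num) ht) hg.le
  · exact fun t ht => mul_pos hs (hpow _ t ht)
  · exact fun t ht => mul_le_mul_of_nonneg_left (rpow_neg_succ_le (by norm_num) ht) hs.le
  · rw [hγT]
    calc 9 * (m : ℝ) * (n * m * G.cMax / (g / τ ^ 3) + 2 * n ^ 2 * m * G.cMax ^ 3 *
          ∑ t ∈ Finset.Icc 1 T, γ t * (m + 1 / (s * (t : ℝ) ^ (-(1 / 5) : ℝ))))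
        ≤ 9 * (m : ℝ) * (n * m * G.cMax / (g / τ ^ 3) + 2 * n ^ 2 * m * G.cMax ^ 3 *
          (g * (m + 1 / s) * (5 / 3 * τ ^ 3))) := by gcongr
      _ = (9 * m * (n * m * G.cMax / g +
          10 / 3 * n ^ 2 * m * G.cMax ^ 3 * g * (m + 1 / s))) * τ ^ 3 := by
          field_simp
          ring
      _ ≤ κ ^ 2 * τ ^ 3 := by gcongr
      _ = T * (κ / τ) ^ 2 := by rw [hT5]; field_simp
  · calc (m : ℝ) ^ 2 * G.cMax * ∑ t ∈ Finset.Icc 1 T, s * (t : ℝ) ^ (-(1 / 5) : ℝ) + T * (κ / τ)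
        ≤ (m : ℝ) ^ 2 * G.cMax * (s * (5 / 4 * τ ^ 4)) + T * (κ / τ) := by gcongr
      _ = (5 / 4 * m ^ 2 * G.cMax * s + κ) * τ ^ 4 := by
          rw [hT5]; field_simp
      _ ≤ τ * ε * τ ^ 4 := by gcongr
      _ = T * ε := by rw [hT5]; ring

end CongestionGame

/-! ### The two explicit horizons -/

theorem le_fifth_root_mul {X ε T : ℝ} (hX : 0 ≤ X) (hε : 0 < ε) (h : X ^ 5 / ε ^ 5 ≤ T) :
    X ≤ T ^ (1 / 5 : ℝ) * ε := by
  rw [← div_le_iff₀ hε, ← div_pow] at *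
  have h0 : 0 ≤ X / ε := by positivity
  calc X / ε = ((X / ε) ^ 5) ^ (1 / 5 : ℝ) := by
        rw [← Real.rpow_natCast, ← Real.rpow_mul h0]; norm_num
    _ ≤ T ^ (1 / 5 : ℝ) := Real.rpow_le_rpow (by positivity) h (by norm_num)

theorem one_le_tenth_root {k : ℕ} (hk : 0 < k) :
    (1 : ℝ) ≤ (k : ℝ) ^ (1 / (10 : ℝ)) ∧ (k : ℝ) = ((k : ℝ) ^ (1 / (10 : ℝ))) ^ 10 := by
  have h1 : (1 : ℝ) ≤ k := by exact_mod_cast hk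
  refine ⟨Real.one_le_rpow h1 (by norm_num), ?_⟩
  rw [← rpow_eq_pow_root (by linarith) 10 10 (q := 1) (by norm_num), Real.rpow_one]

/-- All exponents are multiples of `1/10`, so everything is polynomial in `N = n^(1/10)` and `R =
m^(1/10)`. The initial potential contributes order `N ^ 26 * R ^ 28`, which dominates the noise, of
order `N ^ 4 * R ^ 22 + N ^ 16 * R ^ 23`. The square root `N ^ 13 * R ^ 14` also dominates the bias,
and its fifth power is `n^(13/2) * m ^ 7`. -/
theorem tuned_horizon :
    ∀ M : ℝ, 0 < M → ∀ a : ℝ, 0 < a → ∀ b : ℝ, 0 < b → ∃ C : ℝ, 0 < C ∧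
      ∀ (n m : ℕ), 0 < n → 0 < m → ∀ G : CongestionGame n m, G.cMax ≤ M →
      ∀ ε : ℝ, 0 < ε → ∀ δ : ℝ, 0 < δ → δ < 1 →
      ∀ T : ℕ, 1 ≤ T → C * ((n : ℝ) ^ (13 / 2 : ℝ) * (m : ℝ) ^ 7 / ε ^ 5) ≤ (T : ℝ) →
      ∀ (Ω : Type*) [mΩ : MeasurableSpace Ω] (P : Measure Ω) [IsProbabilityMeasure P]
        (ℱ : Filtration ℕ mΩ) (x : ℕ → Ω → Fin n → EuclideanSpace ℝ (Fin m))
        (π : ℕ → Ω → G.MixedProfile) (p : ℕ → Ω → G.Profile),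
      G.IsRun (G.tunedStep a) (G.tunedExploration b) T P ℱ x π p →
        1 - δ ≤ P.real {ω | (1 - δ) * (T : ℝ) ≤
          (({t : ℕ | t ∈ Set.Icc 1 T ∧ G.IsApproxMixedNE (ε / δ ^ 2) (π t ω)}.ncard : ℕ) : ℝ)} ∧
        1 - δ ≤ (P.prod (uniformOn (Set.Icc 1 T))).real
          {q : Ω × ℕ | G.IsApproxMixedNE (ε / δ) (π q.2 q.1)} := by
  intro M hM a ha b hb
  -- `9 / a` comes from the initial potential and `30 * a * (1 + 1 / b)` from the noise; the summand
  -- `1` ensures `L ≤ L ^ 2`, which avoids a square root in `κ`.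
  set L : ℝ := 1 + 9 / a + 30 * a * (1 + 1 / b) with hL
  have hL1 : 1 ≤ L := by
    have : 0 < 9 / a + 30 * a * (1 + 1 / b) := by positivity
    linarith
  refine ⟨(M * L + 5 / 4 * M * b) ^ 5, by positivity, ?_⟩
  intro n m hn hm G hGM ε hε δ hδ _ T hT hTC Ω mΩ P _ ℱ x π p hrun
  obtain ⟨hN1, hN⟩ := one_le_tenth_root hn
  obtain ⟨hR1, hR⟩ := one_le_tenth_root hm
  have hn0 : (0 : ℝ) ≤ n := by positivity
  have hm0 : (0 : ℝ) ≤ m := by positivity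
  have hc := G.cMax_pos hn hm
  rw [rpow_eq_pow_root hn0 10 65 (by norm_num)] at hTC
  set N : ℝ := (n : ℝ) ^ (1 / (10 : ℝ)) with hNdef
  set R : ℝ := (m : ℝ) ^ (1 / (10 : ℝ)) with hRdef
  set c := G.cMax with hcdef
  have hN0 : 0 < N := by linarith
  have hR0 : 0 < R := by linarith
  have e1 : (n : ℝ) ^ (-(8 / 5) : ℝ) = (N ^ 16)⁻¹ :=
    rpow_neg_eq_pow_root hn0 10 16 (by norm_num)
  have e2 : (n : ℝ) ^ (-(6 / 5) : ℝ) = (N ^ 12)⁻¹ :=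
    rpow_neg_eq_pow_root hn0 10 12 (by norm_num)
  have e3 : (m : ℝ) ^ (-(4 / 5) : ℝ) = (R ^ 8)⁻¹ :=
    rpow_neg_eq_pow_root hm0 10 8 (by norm_num)
  have e4 : (m : ℝ) ^ (-(11 / 10) : ℝ) = (R ^ 11)⁻¹ :=
    rpow_neg_eq_pow_root hm0 10 11 (by norm_num)
  -- The factor `c⁻¹` in the step size makes both variance terms proportional to `c ^ 2`, so `κ`
  -- needs only one factor `M`.
  refine hrun.conclusion_of_rates hm hT (g := a * (R ^ 8)⁻¹ * (N ^ 16)⁻¹ * c⁻¹)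
    (s := b * (N ^ 12)⁻¹ * (R ^ 11)⁻¹) (κ := M * L * (N ^ 13 * R ^ 14))
    (by positivity) (by positivity) (by positivity) hε hδ
    (fun t => by rw [CongestionGame.tunedStep, e1, e3])
    (fun i t => by rw [CongestionGame.tunedExploration, e2, e4]) ?_ ?_
  · rw [← hcdef]
    have h1 : R ^ 10 + N ^ 12 * R ^ 11 / b ≤ (1 + 1 / b) * (N ^ 22 * R ^ 16) := by
      have h2 : R ^ 10 ≤ N ^ 22 * R ^ 16 := by
        calc R ^ 10 = 1 * R ^ 10 := (one_mul _).symm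
          _ ≤ N ^ 22 * R ^ 16 := by
            gcongr
            · exact one_le_pow₀ hN1
            · norm_num
      have h3 : N ^ 12 * R ^ 11 ≤ N ^ 22 * R ^ 16 := by
        gcongr <;> norm_num
      calc _ ≤ N ^ 22 * R ^ 16 + N ^ 22 * R ^ 16 / b := by gcongr
        _ = _ := by ring
    have hL2 : 9 / a + 30 * a * (1 + 1 / b) ≤ L ^ 2 := by
      have : L ≤ L ^ 2 := le_self_pow₀ hL1 two_ne_zero
      linarith
    calc 9 * (m : ℝ) * (n * m * c / (a * (R ^ 8)⁻¹ * (N ^ 16)⁻¹ * c⁻¹) + 10 / 3 * n ^ 2 * m *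
          c ^ 3 * (a * (R ^ 8)⁻¹ * (N ^ 16)⁻¹ * c⁻¹) * (m + 1 / (b * (N ^ 12)⁻¹ * (R ^ 11)⁻¹)))
        = c ^ 2 * (9 / a * (N ^ 26 * R ^ 28) +
          30 * a * (N ^ 4 * R ^ 12) * (R ^ 10 + N ^ 12 * R ^ 11 / b)) := by
          rw [hN, hR]
          field_simp
          ring
      _ ≤ c ^ 2 * (9 / a * (N ^ 26 * R ^ 28) +
          30 * a * (N ^ 4 * R ^ 12) * ((1 + 1 / b) * (N ^ 22 * R ^ 16))) := by gcongr
      _ = c ^ 2 * (9 / a + 30 * a * (1 + 1 / b)) * (N ^ 26 * R ^ 28) := by ring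
      _ ≤ M ^ 2 * L ^ 2 * (N ^ 26 * R ^ 28) := by gcongr
      _ = _ := by ring
  · have h1 : 5 / 4 * (m : ℝ) ^ 2 * G.cMax * (b * (N ^ 12)⁻¹ * (R ^ 11)⁻¹) ≤
        5 / 4 * M * b * (N ^ 13 * R ^ 14) := by
      calc _ = 5 / 4 * c * b * ((N ^ 12)⁻¹ * R ^ 9) := by
            rw [hR, ← hcdef]; field_simp
        _ ≤ 5 / 4 * M * b * (N ^ 13 * R ^ 14) := by
            gcongr
            · exact (inv_le_one_of_one_le₀ (one_le_pow₀ hN1)).trans (one_le_pow₀ hN1)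
            · norm_num
    refine (add_le_add h1 le_rfl).trans (le_trans (le_of_eq ?_) (le_fifth_root_mul
      (X := (M * L + 5 / 4 * M * b) * (N ^ 13 * R ^ 14)) (by positivity) hε
      (le_trans (le_of_eq ?_) hTC)))
    · ring
    · rw [hR]; ring

/-- With `g = s = 1` the variance terms have orders `N ^ 10 * R ^ 20` and `N ^ 20 * R ^ 30`, and the
bias has order `R ^ 20`. The choice `κ` of order `N ^ 15 * R ^ 25` dominates all of them with room
to spare. -/
theorem default_horizon :
    ∀ M : ℝ, 0 < M → ∃ C : ℝ, 0 < C ∧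
      ∀ (n m : ℕ), 0 < n → 0 < m → ∀ G : CongestionGame n m, G.cMax ≤ M →
      ∀ ε : ℝ, 0 < ε → ∀ δ : ℝ, 0 < δ → δ < 1 →
      ∀ T : ℕ, 1 ≤ T →
        C * ((m : ℝ) ^ (25 / 2 : ℝ) * (n : ℝ) ^ (15 / 2 : ℝ) / ε ^ 5) ≤ (T : ℝ) →
      ∀ (Ω : Type*) [mΩ : MeasurableSpace Ω] (P : Measure Ω) [IsProbabilityMeasure P]
        (ℱ : Filtration ℕ mΩ) (x : ℕ → Ω → Fin n → EuclideanSpace ℝ (Fin m))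
        (π : ℕ → Ω → G.MixedProfile) (p : ℕ → Ω → G.Profile),
      G.IsRun CongestionGame.defaultStep G.defaultExploration T P ℱ x π p →
        1 - δ ≤ P.real {ω | (1 - δ) * (T : ℝ) ≤
          (({t : ℕ | t ∈ Set.Icc 1 T ∧ G.IsApproxMixedNE (ε / δ ^ 2) (π t ω)}.ncard : ℕ) : ℝ)} ∧
        1 - δ ≤ (P.prod (uniformOn (Set.Icc 1 T))).real
          {q : Ω × ℕ | G.IsApproxMixedNE (ε / δ) (π q.2 q.1)} := by
  intro M hM
  -- The constant `60` is `9 * (10 / 3) * 2`, the last factor from `m + 1 ≤ 2 * m`.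
  set L : ℝ := 1 + 9 * M + 60 * M ^ 3 with hL
  have hL1 : 1 ≤ L := by
    have : 0 < 9 * M + 60 * M ^ 3 := by positivity
    linarith
  refine ⟨(L + 5 / 4 * M) ^ 5, by positivity, ?_⟩
  intro n m hn hm G hGM ε hε δ hδ _ T hT hTC Ω mΩ P _ ℱ x π p hrun
  obtain ⟨hN1, hN⟩ := one_le_tenth_root hn
  obtain ⟨hR1, hR⟩ := one_le_tenth_root hm
  have hn0 : (0 : ℝ) ≤ n := by positivity
  have hm0 : (0 : ℝ) ≤ m := by positivity
  have hc := G.cMax_pos hn hm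
  rw [rpow_eq_pow_root hn0 10 75 (by norm_num), rpow_eq_pow_root hm0 10 125 (by norm_num)] at hTC
  set N : ℝ := (n : ℝ) ^ (1 / (10 : ℝ)) with hNdef
  set R : ℝ := (m : ℝ) ^ (1 / (10 : ℝ)) with hRdef
  set c := G.cMax with hcdef
  have hN0 : 0 < N := by linarith
  have hR0 : 0 < R := by linarith
  refine hrun.conclusion_of_rates hm hT (g := 1) (s := 1) (κ := L * (N ^ 15 * R ^ 25))
    (by positivity) (by positivity) (by positivity) hε hδ
    (fun t => by rw [CongestionGame.defaultStep, one_mul])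
    (fun i t => by rw [CongestionGame.defaultExploration, one_mul]) ?_ ?_
  · rw [← hcdef]
    have hm1 : (1 : ℝ) ≤ m := by exact_mod_cast hm
    have hL2 : 9 * M + 60 * M ^ 3 ≤ L ^ 2 := by
      have : L ≤ L ^ 2 := le_self_pow₀ hL1 two_ne_zero
      linarith
    calc 9 * (m : ℝ) * (n * m * c / 1 + 10 / 3 * n ^ 2 * m * c ^ 3 * 1 * (m + 1 / 1))
        ≤ 9 * (m : ℝ) * (n * m * c / 1 + 10 / 3 * n ^ 2 * m * c ^ 3 * 1 * (m + m)) := by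
          gcongr
          simpa using hm1
      _ = 9 * c * (N ^ 10 * R ^ 20) + 60 * c ^ 3 * (N ^ 20 * R ^ 30) := by
          rw [hN, hR]
          ring
      _ ≤ 9 * M * (N ^ 30 * R ^ 50) + 60 * M ^ 3 * (N ^ 30 * R ^ 50) := by
          gcongr <;> norm_num
      _ = (9 * M + 60 * M ^ 3) * (N ^ 30 * R ^ 50) := by ring
      _ ≤ L ^ 2 * (N ^ 30 * R ^ 50) := by gcongr
      _ = _ := by ring
  · have h1 : 5 / 4 * (m : ℝ) ^ 2 * G.cMax * 1 ≤ 5 / 4 * M * (N ^ 15 * R ^ 25) := by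
      calc _ = 5 / 4 * c * (1 * R ^ 20) := by
            rw [hR, ← hcdef]; ring
        _ ≤ 5 / 4 * M * (N ^ 15 * R ^ 25) := by
            gcongr
            · exact one_le_pow₀ hN1
            · norm_num
    refine (add_le_add h1 le_rfl).trans (le_trans (le_of_eq ?_) (le_fifth_root_mul
      (X := (L + 5 / 4 * M) * (N ^ 15 * R ^ 25)) (by positivity) hε
      (le_trans (le_of_eq ?_) hTC)))
    · ring
    · ring

end

theorem corollary3p8 :
    -- tuned parameters: horizon of order `n^{6.5} m^7 / ε^5`
    (∀ M : ℝ, 0 < M → ∀ a : ℝ, 0 < a → ∀ b : ℝ, 0 < b → ∃ C : ℝ, 0 < C ∧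
      ∀ (n m : ℕ), 0 < n → 0 < m → ∀ G : CongestionGame n m, G.cMax ≤ M →
      ∀ ε : ℝ, 0 < ε → ∀ δ : ℝ, 0 < δ → δ < 1 →
      ∀ T : ℕ, 1 ≤ T → C * ((n : ℝ) ^ (13 / 2 : ℝ) * (m : ℝ) ^ 7 / ε ^ 5) ≤ (T : ℝ) →
      ∀ (Ω : Type*) [mΩ : MeasurableSpace Ω] (P : Measure Ω) [IsProbabilityMeasure P]
        (ℱ : Filtration ℕ mΩ) (x : ℕ → Ω → Fin n → EuclideanSpace ℝ (Fin m))
        (π : ℕ → Ω → G.MixedProfile) (p : ℕ → Ω → G.Profile),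
      G.IsRun (G.tunedStep a) (G.tunedExploration b) T P ℱ x π p →
        1 - δ ≤ P.real {ω | (1 - δ) * (T : ℝ) ≤
          (({t : ℕ | t ∈ Set.Icc 1 T ∧ G.IsApproxMixedNE (ε / δ ^ 2) (π t ω)}.ncard : ℕ) : ℝ)} ∧
        1 - δ ≤ (P.prod (uniformOn (Set.Icc 1 T))).real
          {q : Ω × ℕ | G.IsApproxMixedNE (ε / δ) (π q.2 q.1)})
    ∧
    -- default parameters: horizon of order `m^{12.5} n^{7.5} / ε^5`
    (∀ M : ℝ, 0 < M → ∃ C : ℝ, 0 < C ∧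
      ∀ (n m : ℕ), 0 < n → 0 < m → ∀ G : CongestionGame n m, G.cMax ≤ M →
      ∀ ε : ℝ, 0 < ε → ∀ δ : ℝ, 0 < δ → δ < 1 →
      ∀ T : ℕ, 1 ≤ T →
        C * ((m : ℝ) ^ (25 / 2 : ℝ) * (n : ℝ) ^ (15 / 2 : ℝ) / ε ^ 5) ≤ (T : ℝ) →
      ∀ (Ω : Type*) [mΩ : MeasurableSpace Ω] (P : Measure Ω) [IsProbabilityMeasure P]
        (ℱ : Filtration ℕ mΩ) (x : ℕ → Ω → Fin n → EuclideanSpace ℝ (Fin m))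
        (π : ℕ → Ω → G.MixedProfile) (p : ℕ → Ω → G.Profile),
      G.IsRun CongestionGame.defaultStep G.defaultExploration T P ℱ x π p →
        1 - δ ≤ P.real {ω | (1 - δ) * (T : ℝ) ≤
          (({t : ℕ | t ∈ Set.Icc 1 T ∧ G.IsApproxMixedNE (ε / δ ^ 2) (π t ω)}.ncard : ℕ) : ℝ)} ∧
        1 - δ ≤ (P.prod (uniformOn (Set.Icc 1 T))).real
          {q : Ω × ℕ | G.IsApproxMixedNE (ε / δ) (π q.2 q.1)}) := by

  exact ⟨tuned_horizon, default_horizon⟩
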